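/- **Theorem.** Let the covariate $X$ be $t$-distributed with five degrees of freedom, with density $f_X$, and consider the quadratic regression model with regression vector $F(x)=(1,x,x^2)^\top$. For $0<\alpha<1$, a subsampling design of proportion $\alpha$ is given by a measurable density $f:\mathbb R\to\mathbb R$ with $0\le f(x)\le f_X(x)$ for all $x$ and $\int f(x)\,dx=\alpha$. Its information matrix is $M(f)=\int F(x)F(x)^\top f(x)\,dx$, and $f$ is called $D$-optimal if it maximizes $\log\det M(f)$ among all subsampling designs of proportion $\alpha$. There is a critical value $\alpha^*\approx 0.082069$ (namely $|\alpha^*-0.082069|<5\cdot10^{-7}$, and in particular $|\alpha^*-0.082065|<5\cdot 10^{-6}$) such that, for every $0<\alpha<1$, a $D$-optimal subsampling design exists, its density $f_{\xi^*}$ is unique up to Lebesgue-null sets, and: 1. if $\alpha<\alpha^*$, then $f_{\xi^*}=f_X\,\mathbf 1_{(-\infty,-a]\cup[-b,b]\cup[a,\infty)}$ for some real numbers $a>b>0$ (depending on $\alpha$); 2. if $\alpha\ge\alpha^*$, then $f_{\xi^*}=f_X\,\mathbf 1_{(-\infty,-t_{5,1-\alpha/2}]\cup[t_{5,1-\alpha/2},\infty)}$,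 where $t_{5,1-\alpha/2}$ is the $(1-\alpha/2)$-quantile of the $t_5$-distribution. -/

import Mathlib

open MeasureTheory

noncomputable section

/-- The density of Student's `t`-distribution with `ν` degrees of freedom. -/
def studentTPDF (ν x : ℝ) : ℝ :=
  Real.Gamma ((ν + 1) / 2) / (Real.sqrt (ν * Real.pi) * Real.Gamma (ν / 2)) *
    (1 + x ^ 2 / ν) ^ (-((ν + 1) / 2))

/-- Student's `t`-distribution with `ν` degrees of freedom, as a measure on `ℝ`. -/
def studentTMeasure (ν : ℝ) : Measure ℝ :=
  volume.withDensity fun x => ENNReal.ofReal (studentTPDF ν x)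

/-- The `p`-quantile of a distribution `μ` on `ℝ`: the least `x` with `μ ((-∞, x]) ≥ p`. -/
def quantile (μ : Measure ℝ) (p : ℝ) : ℝ :=
  sInf {x : ℝ | p ≤ μ.real (Set.Iic x)}

/-- The vector `(1, x, …, x ^ q)` of regression functions in polynomial regression of degree `q`. -/
def regressionVector (q : ℕ) (x : ℝ) : Fin (q + 1) → ℝ :=
  fun j => x ^ (j : ℕ)

/-- `f` is the density of a continuous subsampling design for the subsampling proportion `α`,
when the covariate has density `fX`: a density of total mass `α` that is bounded by `fX`. -/
structure IsSubsamplingDesign (fX : ℝ → ℝ) (α : ℝ) (f : ℝ → ℝ) : Prop where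
  measurable : Measurable f
  nonneg : ∀ x, 0 ≤ f x
  le : ∀ x, f x ≤ fX x
  integrable : Integrable f
  integral_eq : ∫ x, f x = α

/-- The information matrix `∫ F(x) F(x)ᵀ f(x) dx` of the design with density `f` in polynomial
regression of degree `q`, where `F` is the vector of regression functions. -/
def infoMatrix (q : ℕ) (f : ℝ → ℝ) : Matrix (Fin (q + 1)) (Fin (q + 1)) ℝ :=
  Matrix.of fun i j =>
    ∫ x, Matrix.vecMulVec (regressionVector q x) (regressionVector q x) i j * f x

/-- The `D`-criterion `log det M(ξ)` of the design with density `f`. -/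
def dCriterion (q : ℕ) (f : ℝ → ℝ) : ℝ :=
  Real.log (infoMatrix q f).det

/-- `f` is the density of a `D`-optimal subsampling design in polynomial regression of degree `q`
with covariate density `fX` and subsampling proportion `α`. -/
def IsDOptimal (q : ℕ) (fX : ℝ → ℝ) (α : ℝ) (f : ℝ → ℝ) : Prop :=
  IsSubsamplingDesign fX α f ∧
    ∀ g : ℝ → ℝ, IsSubsamplingDesign fX α g → dCriterion q g ≤ dCriterion q f

/-- `f` is the density, unique up to Lebesgue-null sets, of the `D`-optimal subsampling design. -/
def IsTheDOptimalDensity (q : ℕ) (fX : ℝ → ℝ) (α : ℝ) (f : ℝ → ℝ) : Prop :=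
  IsDOptimal q fX α f ∧ ∀ g : ℝ → ℝ, IsDOptimal q fX α g → g =ᵐ[volume] f

end

/-! The determinant depends on a design `f` only through its moments m_k = ∫ x^k f, and positivity
of M(f) gives det M(f) ≤ m₂(αm₄ − m₂²), with equality when m₁ = m₃ = 0. Since log and −m₂² are
concave, a tangent bound at a symmetric `f` yields log det M(g) ≤ log det M(f) − Γ ∫ (x² − A)(x² −
B)(f − g), with Γ > 0. The moments of `f` prescribe A + B, while AB is free because `f` and `g` have
equal mass. If `f` is f_X where the biquadratic is nonnegative and 0 where it is nonpositive, the
integrand is nonnegative, so `f` is optimal; it is unique because the roots form a null set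
(`isTheDOptimalDensity_indicator`).

With a = √5 cot(y/2) and b = √5 tan(z/2) the truncated moments of t₅ become elementary in y and z.
For two tails A = a², and what remains is B ≤ 0, that is `0 ≤ tailCriterion y`. This criterion is a
quadratic in y over sin y and cos y; one factor is positive, the other is `critGap`. The sign of the
derivative of `critGap` is governed by a quintic that decreases in cos y, so `critGap`, which starts
at 0, keeps increasing once it is nonnegative. Hence the criterion changes sign once, at an angle
y₀, and α* = `tailMass y₀ / (3 * π)` (`exists_criticalAngle`).

Below α*, move mass from the tails to a central interval with the total fixed. The defect in the
moment condition for A = a², B = b² has opposite signs at the two extremes, so it vanishes in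
between (`exists_angles`). -/

/-! ### The sign of the two-tail criterion -/

/-- The ratio `y / sin y` at which the tail criterion vanishes, as a function of `cos y`. -/
noncomputable def critRatio (c : ℝ) : ℝ :=
  (7 * c ^ 2 - 3 * c + 2 + 2 * (1 - c) * Real.sqrt (13 * c ^ 2 + 14 * c + 37)) / (9 - 3 * c)

/-- The factor of the tail criterion that carries its sign. -/
noncomputable def critGap (y : ℝ) : ℝ := y - Real.sin y * critRatio (Real.cos y)

/-- `16 / 3π` times the scaled mass of the tails `|x| ≥ √5 cot (y / 2)`. -/
noncomputable def tailMass (y : ℝ) : ℝ := 3 * y - 4 * Real.sin y + Real.sin y * Real.cos y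

/-- The sign of this function decides whether the two-tailed design is optimal. -/
noncomputable def tailCriterion (y : ℝ) : ℝ :=
  tailMass y * (y - Real.sin y * Real.cos y) * (1 + Real.cos y) +
    (tailMass y * (3 * y + 4 * Real.sin y + Real.sin y * Real.cos y) -
      3 * (y - Real.sin y * Real.cos y) ^ 2) * (1 - Real.cos y)

lemma critRadicand_pos (c : ℝ) : 0 < 13 * c ^ 2 + 14 * c + 37 := by
  nlinarith [sq_nonneg (c + 7 / 13)]

lemma hasDerivAt_critRatio {c : ℝ} (hc : c ≤ 1) :
    HasDerivAt critRatio
      (((14 * c - 3 - 2 * Real.sqrt (13 * c ^ 2 + 14 * c + 37) +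
        2 * (1 - c) * (13 * c + 7) / Real.sqrt (13 * c ^ 2 + 14 * c + 37)) * (9 - 3 * c) +
        3 * (7 * c ^ 2 - 3 * c + 2 + 2 * (1 - c) * Real.sqrt (13 * c ^ 2 + 14 * c + 37))) /
        (9 - 3 * c) ^ 2) c := by
  have hR := critRadicand_pos c
  have hR' : Real.sqrt (13 * c ^ 2 + 14 * c + 37) ≠ 0 := (Real.sqrt_pos.2 hR).ne'
  have h0 : HasDerivAt (fun c : ℝ => 13 * c ^ 2 + 14 * c + 37) (26 * c + 14) c := by
    refine (((((hasDerivAt_id' c).fun_pow 2).const_mul 13).fun_add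
      ((hasDerivAt_id' c).const_mul 14)).add_const 37).congr_deriv ?_
    norm_num; ring
  have h1 := h0.sqrt hR.ne'
  have h2 : HasDerivAt (fun c : ℝ => 7 * c ^ 2 - 3 * c + 2) (14 * c - 3) c := by
    refine (((((hasDerivAt_id' c).fun_pow 2).const_mul 7).fun_sub
      ((hasDerivAt_id' c).const_mul 3)).add_const 2).congr_deriv ?_
    norm_num; ring
  have h3 : HasDerivAt (fun c : ℝ => 2 * (1 - c)) (-2) c := by
    exact (((hasDerivAt_id' c).const_sub 1).const_mul 2).congr_deriv (by norm_num)
  have h4 : HasDerivAt (fun c : ℝ => 9 - 3 * c) (-3) c := by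
    exact (((hasDerivAt_id' c).const_mul 3).const_sub 9).congr_deriv (by norm_num)
  have hne : (9 - 3 * c) ≠ 0 := by linarith
  refine ((h2.fun_add (h3.fun_mul h1)).fun_div h4 hne).congr_deriv ?_
  generalize Real.sqrt (13 * c ^ 2 + 14 * c + 37) = R at hR'
  rw [div_left_inj' (pow_ne_zero 2 hne)]
  field_simp
  ring

/-- Isolates the sign: with c = cos y and R the square root, the first factor is positive for 0 < y
< π, leaving an expression b(c) R + a(c) with polynomials a and b. -/
lemma hasDerivAt_critGap (y : ℝ) :
    HasDerivAt critGap
      (6 * (1 - Real.cos y) /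
        (Real.sqrt (13 * Real.cos y ^ 2 + 14 * Real.cos y + 37) * (9 - 3 * Real.cos y) ^ 2) *
        ((-7 * Real.cos y ^ 3 + 26 * Real.cos y ^ 2 + 19 * Real.cos y + 10) *
          Real.sqrt (13 * Real.cos y ^ 2 + 14 * Real.cos y + 37) +
          (26 * Real.cos y ^ 4 - 83 * Real.cos y ^ 3 - 93 * Real.cos y ^ 2 -
            181 * Real.cos y - 53))) y := by
  have hT := (hasDerivAt_critRatio (Real.cos_le_one y)).comp y (Real.hasDerivAt_cos y)
  have h := (hasDerivAt_id' y).fun_sub ((Real.hasDerivAt_sin y).fun_mul hT)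
  have hs := Real.sin_sq y
  have hne : (9 - 3 * Real.cos y) ≠ 0 := by linarith [Real.cos_le_one y]
  have hR := critRadicand_pos (Real.cos y)
  have hsq := Real.sq_sqrt hR.le
  have hR' := (Real.sqrt_pos.2 hR).ne'
  refine h.congr_deriv ?_
  unfold critRatio
  simp only [Function.comp_apply]
  generalize Real.sqrt (13 * Real.cos y ^ 2 + 14 * Real.cos y + 37) = R at *
  generalize Real.cos y = c at *
  generalize Real.sin y = s at *
  have hc3 : (3 - c) ≠ 0 := by intro h; apply hne; linarith
  have key : ∀ X : ℝ, s * (X * -s) = -(1 - c ^ 2) * X := by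
    intro X; rw [← hs]; ring
  rw [key]
  rw [show (9 - 3 * c) = 3 * (3 - c) by ring]
  field_simp
  linear_combination -(12 + 18 * c - 36 * c ^ 2 + 6 * c ^ 3) * hsq

/-- After sin² y = 1 − cos² y the criterion is a quadratic in y with leading coefficient 9 − 3 cos
y. Its roots are sin y times the two conjugate ratios, `critRatio` being the larger; the radicand
comes from the discriminant. -/
lemma tailCriterion_eq (y : ℝ) :
    tailCriterion y = (9 - 3 * Real.cos y) * critGap y *
      (y - Real.sin y * ((7 * Real.cos y ^ 2 - 3 * Real.cos y + 2 - 2 * (1 - Real.cos y) *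
        Real.sqrt (13 * Real.cos y ^ 2 + 14 * Real.cos y + 37)) / (9 - 3 * Real.cos y))) := by
  have hs := Real.sin_sq y
  have hne : (9 - 3 * Real.cos y) ≠ 0 := by linarith [Real.cos_le_one y]
  have hsq := Real.sq_sqrt (critRadicand_pos (Real.cos y)).le
  unfold tailCriterion critGap tailMass critRatio
  generalize Real.sqrt (13 * Real.cos y ^ 2 + 14 * Real.cos y + 37) = R at *
  generalize Real.cos y = c at *
  generalize Real.sin y = s at *
  have e : (9 - 3 * c) * (y - s * ((7 * c ^ 2 - 3 * c + 2 + 2 * (1 - c) * R) / (9 - 3 * c))) *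
      (y - s * ((7 * c ^ 2 - 3 * c + 2 - 2 * (1 - c) * R) / (9 - 3 * c))) =
      (9 - 3 * c) * y ^ 2 - 2 * y * s * (7 * c ^ 2 - 3 * c + 2) +
        s ^ 2 * ((7 * c ^ 2 - 3 * c + 2) ^ 2 - 4 * (1 - c) ^ 2 * R ^ 2) / (9 - 3 * c) := by
    field_simp; ring
  have e2 : ((7 * c ^ 2 - 3 * c + 2) ^ 2 - 4 * (1 - c) ^ 2 * R ^ 2) / (9 - 3 * c) =
      c ^ 3 + c ^ 2 + 20 * c - 16 := by
    rw [hsq, div_eq_iff hne]; ring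
  rw [e, mul_div_assoc, e2]
  ring

/-- The smaller ratio is at most 1, and sin y < y. -/
lemma tailCriterion_factor_pos {y : ℝ} (h0 : 0 < y) (hpi : y < Real.pi) :
    0 < (9 - 3 * Real.cos y) *
      (y - Real.sin y * ((7 * Real.cos y ^ 2 - 3 * Real.cos y + 2 - 2 * (1 - Real.cos y) *
        Real.sqrt (13 * Real.cos y ^ 2 + 14 * Real.cos y + 37)) / (9 - 3 * Real.cos y))) := by
  have h9 : 0 < 9 - 3 * Real.cos y := by linarith [Real.cos_le_one y]
  apply mul_pos h9
  have hs := Real.sin_pos_of_pos_of_lt_pi h0 hpi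
  have hlt := Real.sin_lt h0
  have hR := Real.sqrt_nonneg (13 * Real.cos y ^ 2 + 14 * Real.cos y + 37)
  have : (7 * Real.cos y ^ 2 - 3 * Real.cos y + 2 - 2 * (1 - Real.cos y) *
        Real.sqrt (13 * Real.cos y ^ 2 + 14 * Real.cos y + 37)) / (9 - 3 * Real.cos y) ≤ 1 := by
    rw [div_le_one h9]
    nlinarith [Real.cos_le_one y, Real.neg_one_le_cos y,
      mul_nonneg (sub_nonneg.2 (Real.cos_le_one y)) hR]
  nlinarith

lemma tailCriterion_neg {y : ℝ} (h0 : 0 < y) (hpi : y < Real.pi) (h : critGap y < 0) :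
    tailCriterion y < 0 := by
  rw [tailCriterion_eq]
  nlinarith [tailCriterion_factor_pos h0 hpi]

lemma tailCriterion_nonneg {y : ℝ} (h0 : 0 < y) (hpi : y < Real.pi) (h : 0 ≤ critGap y) :
    0 ≤ tailCriterion y := by
  rw [tailCriterion_eq]
  nlinarith [tailCriterion_factor_pos h0 hpi]

/-- The quintic is the nontrivial factor in b²R² − a² = 3(1 − c)(1 + c)² · quintic, for a and b as
in the derivative of `critGap`. Monotonicity allows it a single sign change. -/
lemma critQuintic_strictAnti {c d : ℝ} (hc : -1 ≤ c) (hcd : c < d) (hd : d ≤ 1) :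
    297 - 1539 * d + 702 * d ^ 2 + 118 * d ^ 3 - 103 * d ^ 4 + 13 * d ^ 5 <
      297 - 1539 * c + 702 * c ^ 2 + 118 * c ^ 3 - 103 * c ^ 4 + 13 * c ^ 5 := by
  have hanti : StrictAntiOn (fun c : ℝ => 297 - 1539 * c + 702 * c ^ 2 + 118 * c ^ 3 -
      103 * c ^ 4 + 13 * c ^ 5) (Set.Icc (-1) 1) := by
    apply strictAntiOn_of_deriv_neg (convex_Icc _ _) (by fun_prop)
    intro x hx
    rw [interior_Icc] at hx
    have hd : HasDerivAt (fun c : ℝ => 297 - 1539 * c + 702 * c ^ 2 + 118 * c ^ 3 -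
      103 * c ^ 4 + 13 * c ^ 5) (-1539 + 1404 * x + 354 * x ^ 2 - 412 * x ^ 3 + 65 * x ^ 4) x := by
      have h0 := hasDerivAt_id' x
      have h1 := (h0.const_mul 1539).const_sub 297
      have h2 := h1.fun_add ((h0.fun_pow 2).const_mul 702)
      have h3 := h2.fun_add ((h0.fun_pow 3).const_mul 118)
      have h4 := h3.fun_sub ((h0.fun_pow 4).const_mul 103)
      refine (h4.fun_add ((h0.fun_pow 5).const_mul 13)).congr_deriv ?_
      norm_num; ring
    rw [hd.deriv]
    obtain ⟨h1, h2⟩ := hx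
    have hx2 : x ^ 2 ≤ 1 := by nlinarith
    rcases le_total x 0 with h | h
    · nlinarith [mul_nonneg (neg_nonneg.2 h) (sq_nonneg x), sq_nonneg (x ^ 2)]
    · nlinarith [mul_nonneg h (sq_nonneg x), sq_nonneg (x ^ 2), mul_nonneg h (sq_nonneg (x - 1)),
        mul_nonneg (mul_nonneg h h) (sub_nonneg.2 h2.le)]
  exact hanti ⟨hc, by linarith⟩ ⟨by linarith, hd⟩ hcd

/-- For c ≤ 0 the quintic is at least its value 297 at 0. For c > 0 the part a without R is
negative, so the hypothesis can be squared. -/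
lemma critQuintic_nonneg {c R : ℝ} (hc : -1 < c) (hc1 : c < 1)
    (hsq : R ^ 2 = 13 * c ^ 2 + 14 * c + 37)
    (h : 0 ≤ (-7 * c ^ 3 + 26 * c ^ 2 + 19 * c + 10) * R +
      (26 * c ^ 4 - 83 * c ^ 3 - 93 * c ^ 2 - 181 * c - 53)) :
    0 ≤ 297 - 1539 * c + 702 * c ^ 2 + 118 * c ^ 3 - 103 * c ^ 4 + 13 * c ^ 5 := by
  rcases le_or_gt c 0 with h0 | h0
  · rcases h0.eq_or_lt with rfl | h0
    · norm_num
    · have := critQuintic_strictAnti hc.le h0 zero_le_one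
      norm_num at this
      linarith
  · have ha : 26 * c ^ 4 - 83 * c ^ 3 - 93 * c ^ 2 - 181 * c - 53 < 0 := by
      have : c ^ 4 ≤ c ^ 3 := pow_le_pow_of_le_one h0.le hc1.le (by norm_num)
      have := pow_pos h0 3
      nlinarith
    have hL : (-(26 * c ^ 4 - 83 * c ^ 3 - 93 * c ^ 2 - 181 * c - 53)) ^ 2 ≤
        ((-7 * c ^ 3 + 26 * c ^ 2 + 19 * c + 10) * R) ^ 2 :=
      pow_le_pow_left₀ (by linarith) (by linarith) 2
    rw [mul_pow, hsq] at hL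
    have hL' : 0 ≤ 3 * ((1 - c) * (1 + c) ^ 2) *
        (297 - 1539 * c + 702 * c ^ 2 + 118 * c ^ 3 - 103 * c ^ 4 + 13 * c ^ 5) := by
      linarith
    have hp : 0 < 3 * ((1 - c) * (1 + c) ^ 2) := by
      have : 0 < (1 + c) ^ 2 := by apply pow_pos; linarith
      have : 0 < (1 - c) := by linarith
      positivity
    exact nonneg_of_mul_nonneg_right hL' hp

lemma critSlope_pos {c R : ℝ} (hc : -1 < c) (hc1 : c < 1) (hR : 0 ≤ R)
    (hsq : R ^ 2 = 13 * c ^ 2 + 14 * c + 37)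
    (h : 0 < 297 - 1539 * c + 702 * c ^ 2 + 118 * c ^ 3 - 103 * c ^ 4 + 13 * c ^ 5) :
    0 < (-7 * c ^ 3 + 26 * c ^ 2 + 19 * c + 10) * R +
      (26 * c ^ 4 - 83 * c ^ 3 - 93 * c ^ 2 - 181 * c - 53) := by
  have hb : 0 < -7 * c ^ 3 + 26 * c ^ 2 + 19 * c + 10 := by
    nlinarith [mul_nonneg (sq_nonneg c) (sub_nonneg.2 hc1.le), sq_nonneg (c + 1 / 2)]
  have hp : 0 < 3 * ((1 - c) * (1 + c) ^ 2) := by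
    have : 0 < (1 + c) ^ 2 := by apply pow_pos; linarith
    have : 0 < (1 - c) := by linarith
    positivity
  have hL : (26 * c ^ 4 - 83 * c ^ 3 - 93 * c ^ 2 - 181 * c - 53) ^ 2 <
      ((-7 * c ^ 3 + 26 * c ^ 2 + 19 * c + 10) * R) ^ 2 := by
    rw [mul_pow, hsq]
    have := mul_pos hp h
    linarith
  have := (abs_lt.1 (abs_lt_of_sq_lt_sq hL (mul_nonneg hb.le hR))).1
  linarith

/-- Once the gap is nonnegative, it increases. -/
lemma critGap_lt_critGap {y z : ℝ} (hy : 0 < y) (hyz : y < z) (hz : z < Real.pi)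
    (h : 0 ≤ critGap y) : critGap y < critGap z := by
  have hcont : Continuous critGap :=
    continuous_iff_continuousAt.2 fun x => (hasDerivAt_critGap x).continuousAt
  -- As `critGap 0 = 0`, the mean value theorem on [0, y] gives a point ξ < y where the derivative
  -- is nonnegative, hence so is the quintic.
  obtain ⟨ξ, hξ, hξ'⟩ := exists_hasDerivAt_eq_slope critGap _ hy hcont.continuousOn
    (fun x _ => hasDerivAt_critGap x)
  have h0 : critGap 0 = 0 := by simp [critGap]
  have hcos : ∀ x, 0 < x → x < Real.pi → -1 < Real.cos x ∧ Real.cos x < 1 := by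
    intro x hx hxp
    have hs := Real.sin_pos_of_pos_of_lt_pi hx hxp
    have := Real.sin_sq_add_cos_sq x
    constructor <;> nlinarith
  have hpre : ∀ x, 0 < x → x < Real.pi → 0 < 6 * (1 - Real.cos x) /
      (Real.sqrt (13 * Real.cos x ^ 2 + 14 * Real.cos x + 37) * (9 - 3 * Real.cos x) ^ 2) := by
    intro x hx hxp
    obtain ⟨-, h2⟩ := hcos x hx hxp
    have := Real.sqrt_pos.2 (critRadicand_pos (Real.cos x))
    have h9 : 0 < (9 - 3 * Real.cos x) ^ 2 := by apply pow_pos; linarith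
    have : 0 < 1 - Real.cos x := by linarith
    positivity
  have hξpi : ξ < Real.pi := hξ.2.trans (hyz.trans hz)
  have hc := hcos ξ hξ.1 hξpi
  have hm := critQuintic_nonneg hc.1 hc.2
    (Real.sq_sqrt (critRadicand_pos _).le)
    (nonneg_of_mul_nonneg_right
      (by rw [hξ', h0, sub_zero, sub_zero]; positivity) (hpre ξ hξ.1 hξpi))
  have hmono : StrictMonoOn critGap (Set.Icc y z) := by
    apply strictMonoOn_of_deriv_pos (convex_Icc _ _) hcont.continuousOn
    intro x hx
    rw [interior_Icc] at hx
    rw [(hasDerivAt_critGap x).deriv]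
    have hx0 : 0 < x := hy.trans hx.1
    have hxp : x < Real.pi := hx.2.trans hz
    apply mul_pos (hpre x hx0 hxp)
    have hcx := hcos x hx0 hxp
    apply critSlope_pos hcx.1 hcx.2 (Real.sqrt_nonneg _) (Real.sq_sqrt (critRadicand_pos _).le)
    -- Beyond ξ the cosine is smaller, so the quintic is strictly positive and the slope with it.
    have hlt : Real.cos x < Real.cos ξ :=
      Real.cos_lt_cos_of_nonneg_of_le_pi hξ.1.le hxp.le (hξ.2.trans hx.1)
    exact hm.trans_lt (critQuintic_strictAnti hcx.1.le hlt hc.2.le)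
  exact hmono ⟨le_rfl, hyz.le⟩ ⟨hyz.le, le_rfl⟩ hyz

/-! ### Tail mass and the numerical location of the critical angle -/

lemma tailMass_hasDerivAt (y : ℝ) : HasDerivAt tailMass (2 * (1 - Real.cos y) ^ 2) y := by
  have h := (((hasDerivAt_id' y).const_mul 3).fun_sub ((Real.hasDerivAt_sin y).const_mul 4)).fun_add
    ((Real.hasDerivAt_sin y).fun_mul (Real.hasDerivAt_cos y))
  refine h.congr_deriv ?_
  have := Real.sin_sq y
  linear_combination -this

lemma tailMass_continuous : Continuous tailMass :=
  continuous_iff_continuousAt.2 fun y => (tailMass_hasDerivAt y).continuousAt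

lemma tailMass_strictMonoOn : StrictMonoOn tailMass (Set.Icc 0 Real.pi) := by
  apply strictMonoOn_of_deriv_pos (convex_Icc _ _) tailMass_continuous.continuousOn
  intro y hy
  rw [interior_Icc] at hy
  rw [(tailMass_hasDerivAt y).deriv]
  have hs := Real.sin_pos_of_pos_of_lt_pi hy.1 hy.2
  have := Real.sin_sq_add_cos_sq y
  have : 0 < 1 - Real.cos y := by nlinarith
  positivity

lemma tailMass_zero : tailMass 0 = 0 := by simp [tailMass]

lemma tailMass_pi : tailMass Real.pi = 3 * Real.pi := by simp [tailMass]

/-- The critical angle lies just above π/2, so Taylor bounds at the small shift y − π/2 are sharp.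
The shift is enclosed in [e₀, e₁] because π is known only to finitely many digits. -/
lemma sin_cos_bounds_near_pi_div_two {y e₀ e₁ : ℝ} (h0 : 0 ≤ e₀) (h : e₀ ≤ y - Real.pi / 2)
    (h' : y - Real.pi / 2 ≤ e₁) (h1 : e₁ ≤ 1) :
    -e₁ + e₀ ^ 3 / 6 - e₁ ^ 5 / 100 ≤ Real.cos y ∧
      Real.cos y ≤ -e₀ + e₁ ^ 3 / 6 + e₁ ^ 5 / 100 ∧
      1 - e₁ ^ 2 / 2 - e₁ ^ 4 * (5 / 96) ≤ Real.sin y ∧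
      Real.sin y ≤ 1 - e₀ ^ 2 / 2 + e₁ ^ 4 * (5 / 96) := by
  obtain ⟨e, rfl⟩ : ∃ e, y = e + Real.pi / 2 := ⟨y - Real.pi / 2, by ring⟩
  rw [add_sub_cancel_right] at h h'
  rw [Real.cos_add_pi_div_two, Real.sin_add_pi_div_two]
  have he : 0 ≤ e := h0.trans h
  have habs : |e| ≤ 1 := by rw [abs_of_nonneg he]; linarith
  have hs := abs_le.1 (Real.sin_bound habs)
  have hc := abs_le.1 (Real.cos_bound habs)
  rw [abs_of_nonneg he] at hs hc
  have := pow_le_pow_left₀ he h' 5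
  have := pow_le_pow_left₀ he h' 4
  have := pow_le_pow_left₀ he h' 3
  have := pow_le_pow_left₀ h0 h 3
  have := pow_le_pow_left₀ he h' 2
  have := pow_le_pow_left₀ h0 h 2
  refine ⟨?_, ?_, ?_, ?_⟩ <;> linarith [hs.1, hs.2, hc.1, hc.2]

/-- Linear in sin y with a coefficient of known sign, so one-sided bounds on sin y suffice for the
numerical estimates. -/
lemma tailCriterion_eq_sin (y : ℝ) :
    tailCriterion y = (9 - 3 * Real.cos y) * y ^ 2 +
      (Real.cos y ^ 3 + Real.cos y ^ 2 + 20 * Real.cos y - 16) * (1 - Real.cos y ^ 2) -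
      (14 * Real.cos y ^ 2 - 6 * Real.cos y + 4) * y * Real.sin y := by
  rw [← Real.sin_sq, tailCriterion, tailMass]
  ring

lemma tailCriterion_lower : tailCriterion 1.6004525 < 0 ∧
    0.0820685 < tailMass 1.6004525 / (3 * Real.pi) := by
  have hp1 := Real.pi_gt_d20
  have hp2 := Real.pi_lt_d20
  obtain ⟨hc1, hc2, hs1, hs2⟩ := sin_cos_bounds_near_pi_div_two (y := 1.6004525)
    (e₀ := 0.0296561732) (e₁ := 0.0296561733) (by norm_num) (by linarith) (by linarith)
    (by norm_num)
  norm_num at hc1 hc2 hs1 hs2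
  have hc3 : (-0.0296518265 : ℝ) ≤ Real.cos 1.6004525 := by norm_num; linarith
  have hc4 : Real.cos 1.6004525 ≤ -0.0296518259 := by norm_num; linarith
  have hs3 : (0.9995602146 : ℝ) ≤ Real.sin 1.6004525 := by norm_num; linarith
  have hs4 : Real.sin 1.6004525 ≤ 0.9995602961 := by norm_num; linarith
  constructor
  · rw [tailCriterion_eq_sin]
    generalize Real.cos 1.6004525 = c at *
    generalize Real.sin 1.6004525 = s at *
    have hq : 0 < 14 * c ^ 2 - 6 * c + 4 := by nlinarith
    have : (14 * c ^ 2 - 6 * c + 4) * 1.6004525 * 0.9995602146 ≤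
      (14 * c ^ 2 - 6 * c + 4) * 1.6004525 * s := by gcongr
    -- Expanding around an endpoint of the enclosure of cos y leaves a polynomial in a tiny d ≥ 0;
    -- bounds on the powers of d make the goal linear.
    obtain ⟨d, rfl⟩ : ∃ d, c = -0.0296518259 - d := ⟨-0.0296518259 - c, by ring⟩
    have hd : 0 ≤ d := by linarith
    have hd1 : d ≤ 0.0000000006 := by linarith
    have h2 : d ^ 2 ≤ d * 0.0000000006 := by nlinarith
    have h2' : 0 ≤ d ^ 2 := by positivity
    have h3 : d ^ 3 ≤ d ^ 2 := pow_le_pow_of_le_one hd (by linarith) (by norm_num)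
    have h3' : 0 ≤ d ^ 3 := by positivity
    have h4 : d ^ 4 ≤ d ^ 2 := pow_le_pow_of_le_one hd (by linarith) (by norm_num)
    have h4' : 0 ≤ d ^ 4 := by positivity
    have h5 : d ^ 5 ≤ d ^ 2 := pow_le_pow_of_le_one hd (by linarith) (by norm_num)
    have h5' : 0 ≤ d ^ 5 := by positivity
    linarith
  · rw [lt_div_iff₀ (by linarith), tailMass]
    nlinarith

lemma tailCriterion_upper : 0 < tailCriterion 1.6004567 ∧
    tailMass 1.6004567 / (3 * Real.pi) < 0.0820695 := by
  have hp1 := Real.pi_gt_d20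
  have hp2 := Real.pi_lt_d20
  obtain ⟨hc1, hc2, hs1, hs2⟩ := sin_cos_bounds_near_pi_div_two (y := 1.6004567)
    (e₀ := 0.0296603732) (e₁ := 0.0296603733) (by norm_num) (by linarith) (by linarith)
    (by norm_num)
  norm_num at hc1 hc2 hs1 hs2
  have hc3 : (-0.0296560247 : ℝ) ≤ Real.cos 1.6004567 := by norm_num; linarith
  have hc4 : Real.cos 1.6004567 ≤ -0.029656024 := by norm_num; linarith
  have hs3 : (0.99956009 : ℝ) ≤ Real.sin 1.6004567 := by norm_num; linarith
  have hs4 : Real.sin 1.6004567 ≤ 0.999560172 := by norm_num; linarith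
  constructor
  · rw [tailCriterion_eq_sin]
    generalize Real.cos 1.6004567 = c at *
    generalize Real.sin 1.6004567 = s at *
    have hq : 0 < 14 * c ^ 2 - 6 * c + 4 := by nlinarith
    have : (14 * c ^ 2 - 6 * c + 4) * 1.6004567 * s ≤
      (14 * c ^ 2 - 6 * c + 4) * 1.6004567 * 0.999560172 := by gcongr
    obtain ⟨d, rfl⟩ : ∃ d, c = -0.0296560247 + d := ⟨c - -0.0296560247, by ring⟩
    have hd : 0 ≤ d := by linarith
    have hd1 : d ≤ 0.0000000007 := by linarith
    have h2 : d ^ 2 ≤ d * 0.0000000007 := by nlinarith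
    have h2' : 0 ≤ d ^ 2 := by positivity
    have h3 : d ^ 3 ≤ d ^ 2 := pow_le_pow_of_le_one hd (by linarith) (by norm_num)
    have h3' : 0 ≤ d ^ 3 := by positivity
    have h4 : d ^ 4 ≤ d ^ 2 := pow_le_pow_of_le_one hd (by linarith) (by norm_num)
    have h4' : 0 ≤ d ^ 4 := by positivity
    have h5 : d ^ 5 ≤ d ^ 2 := pow_le_pow_of_le_one hd (by linarith) (by norm_num)
    have h5' : 0 ≤ d ^ 5 := by positivity
    linarith
  · rw [div_lt_iff₀ (by linarith), tailMass]
    nlinarith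

/-- The critical angle, at which the tail criterion changes its sign. -/
lemma exists_criticalAngle : ∃ y₀ : ℝ, 0 < y₀ ∧ y₀ < Real.pi ∧
    |tailMass y₀ / (3 * Real.pi) - 0.082069| < 0.0000005 ∧
    (∀ y, 0 < y → y < y₀ → tailCriterion y < 0) ∧
    (∀ y, y₀ ≤ y → y < Real.pi → 0 ≤ tailCriterion y) := by
  have hpi := Real.pi_gt_d20
  obtain ⟨hl, hl'⟩ := tailCriterion_lower
  obtain ⟨hu, hu'⟩ := tailCriterion_upper
  have hcont : Continuous critGap :=
    continuous_iff_continuousAt.2 fun x => (hasDerivAt_critGap x).continuousAt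
  have hgl : critGap 1.6004525 < 0 := by
    by_contra! h
    exact absurd (tailCriterion_nonneg (by norm_num) (by linarith) h) (not_le.2 hl)
  have hgu : 0 < critGap 1.6004567 := by
    rw [tailCriterion_eq] at hu
    have := tailCriterion_factor_pos (y := 1.6004567) (by norm_num) (by linarith)
    by_contra! h
    nlinarith
  obtain ⟨y₀, hy, hy0⟩ := intermediate_value_Ioo (by norm_num : (1.6004525 : ℝ) ≤ 1.6004567)
    hcont.continuousOn ⟨hgl, hgu⟩
  have hy0p : 0 < y₀ := lt_trans (by norm_num) hy.1
  have hypi : y₀ < Real.pi := hy.2.trans (by linarith)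
  refine ⟨y₀, hy0p, hypi, ?_, fun y h0 hlt => ?_, fun y hle hlt => ?_⟩
  · have h1 : tailMass 1.6004525 < tailMass y₀ :=
      tailMass_strictMonoOn ⟨by norm_num, by linarith⟩ ⟨hy0p.le, hypi.le⟩ hy.1
    have h2 : tailMass y₀ < tailMass 1.6004567 :=
      tailMass_strictMonoOn ⟨hy0p.le, hypi.le⟩ ⟨by norm_num, by linarith⟩ hy.2
    have h3 : tailMass 1.6004525 / (3 * Real.pi) < tailMass y₀ / (3 * Real.pi) := by gcongr
    have h4 : tailMass y₀ / (3 * Real.pi) < tailMass 1.6004567 / (3 * Real.pi) := by gcongr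
    rw [abs_lt]
    constructor <;> linarith
  · apply tailCriterion_neg h0 (hlt.trans hypi)
    by_contra! h
    have := critGap_lt_critGap h0 hlt hypi h
    linarith
  · apply tailCriterion_nonneg (hy0p.trans_le hle) hlt
    rcases hle.eq_or_lt with rfl | h
    · exact hy0.ge
    · exact hy0.ge.trans (critGap_lt_critGap hy0p h hlt hy0.ge).le

/-! ### Three-interval designs of prescribed mass -/

/-- Clamping the argument to [0, 3π] makes the inverse continuous on all of ℝ, so that compositions
with it need no domain bookkeeping. -/
lemma exists_continuous_tailMass_inverse : ∃ σ : ℝ → ℝ, Continuous σ ∧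
    ∀ t ∈ Set.Icc 0 (3 * Real.pi), σ t ∈ Set.Icc 0 Real.pi ∧ tailMass (σ t) = t := by
  have hpi := Real.pi_pos
  have hmaps : Set.MapsTo tailMass (Set.Icc 0 Real.pi) (Set.Icc 0 (3 * Real.pi)) := by
    intro y hy
    rw [← tailMass_zero, ← tailMass_pi]
    exact ⟨tailMass_strictMonoOn.monotoneOn ⟨le_rfl, hpi.le⟩ hy hy.1,
      tailMass_strictMonoOn.monotoneOn hy ⟨hpi.le, le_rfl⟩ hy.2⟩
  have hmono : StrictMono hmaps.restrict := fun a b hab =>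
    tailMass_strictMonoOn a.2 b.2 hab
  have hsurj : Function.Surjective hmaps.restrict := by
    intro t
    have ht : (t : ℝ) ∈ Set.Icc (tailMass 0) (tailMass Real.pi) := by
      rw [tailMass_zero, tailMass_pi]
      exact t.2
    obtain ⟨y, hy, hyt⟩ := intermediate_value_Icc hpi.le tailMass_continuous.continuousOn ht
    exact ⟨⟨y, hy⟩, Subtype.ext hyt⟩
  let e := hmono.orderIsoOfSurjective _ hsurj
  have h3 : (0 : ℝ) ≤ 3 * Real.pi := by positivity
  refine ⟨fun t => e.symm (Set.projIcc 0 (3 * Real.pi) h3 t),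
    continuous_subtype_val.comp (e.symm.continuous.comp continuous_projIcc), fun t ht => ?_⟩
  refine ⟨(e.symm _).2, ?_⟩
  have := congrArg Subtype.val (e.apply_symm_apply (Set.projIcc 0 (3 * Real.pi) h3 t))
  rwa [congrArg Subtype.val (Set.projIcc_of_mem h3 ht)] at this

lemma sub_sin_mul_cos_pos {z : ℝ} (hz : 0 < z) : 0 < z - Real.sin z * Real.cos z := by
  have := Real.sin_lt (x := 2 * z) (by linarith)
  rw [Real.sin_two_mul] at this
  linarith

/-- If the two-tailed design with tail angle `y₁` violates the optimality condition, there is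
a three-interval design with the same mass that satisfies it. -/
lemma exists_angles {y₁ : ℝ} (h0 : 0 < y₁) (hpi : y₁ < Real.pi) (hneg : tailCriterion y₁ < 0) :
    ∃ y z p₂ p₄ : ℝ, 0 < y ∧ 0 < z ∧ y + z < Real.pi ∧
      tailMass y + (3 * z + 4 * Real.sin z + Real.sin z * Real.cos z) = tailMass y₁ ∧
      p₂ = (y - Real.sin y * Real.cos y) + (z - Real.sin z * Real.cos z) ∧
      p₄ = (3 * y + 4 * Real.sin y + Real.sin y * Real.cos y) +
        (3 * z - 4 * Real.sin z + Real.sin z * Real.cos z) ∧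
      tailMass y₁ * p₂ * ((1 + Real.cos y) * (1 + Real.cos z) +
        (1 - Real.cos z) * (1 - Real.cos y)) =
        (3 * p₂ ^ 2 - tailMass y₁ * p₄) * ((1 - Real.cos y) * (1 + Real.cos z)) := by
  obtain ⟨σ, hσc, hσ⟩ := exists_continuous_tailMass_inverse
  have hpi0 := Real.pi_pos
  set κ := tailMass y₁ with hκ
  have hκ0 : 0 < κ := by
    rw [hκ, ← tailMass_zero]
    exact tailMass_strictMonoOn ⟨le_rfl, hpi0.le⟩ ⟨h0.le, hpi.le⟩ h0
  have hκ1 : κ < 3 * Real.pi := by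
    rw [hκ, ← tailMass_pi]
    exact tailMass_strictMonoOn ⟨h0.le, hpi.le⟩ ⟨hpi0.le, le_rfl⟩ hpi
  -- The central angle that restores the mass κ. A central interval of angle z has scaled mass 3π −
  -- `tailMass (π - z)`, since its complement is a pair of tails.
  let Z : ℝ → ℝ := fun y => Real.pi - σ (3 * Real.pi - κ + tailMass y)
  have hZc : Continuous Z :=
    continuous_const.sub (hσc.comp (continuous_const.add tailMass_continuous))
  have hmem : ∀ y ∈ Set.Icc 0 y₁, tailMass y ∈ Set.Icc 0 κ := by
    intro y hy
    have hy' : y ∈ Set.Icc 0 Real.pi := ⟨hy.1, hy.2.trans hpi.le⟩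
    rw [← tailMass_zero, hκ]
    exact ⟨tailMass_strictMonoOn.monotoneOn ⟨le_rfl, hpi0.le⟩ hy' hy.1,
      tailMass_strictMonoOn.monotoneOn hy' ⟨h0.le, hpi.le⟩ hy.2⟩
  have hZ : ∀ y ∈ Set.Icc 0 y₁, Z y ∈ Set.Icc 0 Real.pi ∧
      tailMass (Real.pi - Z y) = 3 * Real.pi - κ + tailMass y := by
    intro y hy
    obtain ⟨h1, h2⟩ := hσ (3 * Real.pi - κ + tailMass y)
      ⟨by linarith [(hmem y hy).1], by linarith [(hmem y hy).2]⟩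
    simp only [Z, sub_sub_cancel]
    exact ⟨⟨by linarith [h1.2], by linarith [h1.1]⟩, h2⟩
  have hmass : ∀ z, tailMass (Real.pi - z) =
      3 * Real.pi - (3 * z + 4 * Real.sin z + Real.sin z * Real.cos z) := by
    intro z
    rw [tailMass, Real.sin_pi_sub, Real.cos_pi_sub]
    ring
  have hlt : ∀ {s t}, s ∈ Set.Icc 0 Real.pi → t ∈ Set.Icc 0 Real.pi → tailMass s < tailMass t →
      s < t := fun hs ht h => (tailMass_strictMonoOn.lt_iff_lt hs ht).1 h
  -- Defect in the condition on a² + b², multiplied by (1 − cos y)(1 + cos z) so that it makes sense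
  -- at y = 0, where a is infinite.
  let E : ℝ → ℝ := fun y =>
    (κ * ((y - Real.sin y * Real.cos y) + (Z y - Real.sin (Z y) * Real.cos (Z y))) *
        ((1 + Real.cos y) * (1 + Real.cos (Z y)) + (1 - Real.cos (Z y)) * (1 - Real.cos y)) -
      (3 * ((y - Real.sin y * Real.cos y) + (Z y - Real.sin (Z y) * Real.cos (Z y))) ^ 2 -
        κ * ((3 * y + 4 * Real.sin y + Real.sin y * Real.cos y) +
          (3 * Z y - 4 * Real.sin (Z y) + Real.sin (Z y) * Real.cos (Z y)))) *
        ((1 - Real.cos y) * (1 + Real.cos (Z y))))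
  have hEc : Continuous E := by fun_prop
  have hE0 : 0 < E 0 := by
    obtain ⟨hm, ht⟩ := hZ 0 ⟨le_rfl, h0.le⟩
    rw [tailMass_zero, add_zero] at ht
    have hm' : Real.pi - Z 0 ∈ Set.Icc 0 Real.pi := ⟨by linarith [hm.2], by linarith [hm.1]⟩
    have hz1 := hlt hm' ⟨hpi0.le, le_rfl⟩ (by rw [ht, tailMass_pi]; linarith)
    have hz2 := hlt ⟨le_rfl, hpi0.le⟩ hm' (by rw [ht, tailMass_zero]; linarith)
    have hz := sub_sin_mul_cos_pos (z := Z 0) (by linarith)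
    have hc : -1 < Real.cos (Z 0) := by
      rw [← Real.cos_pi]
      exact Real.cos_lt_cos_of_nonneg_of_le_pi hm.1 le_rfl (by linarith)
    have hc' : 0 < 1 + Real.cos (Z 0) := by linarith
    have : E 0 = 2 * (κ * (Z 0 - Real.sin (Z 0) * Real.cos (Z 0)) * (1 + Real.cos (Z 0))) := by
      simp only [E, Real.sin_zero, Real.cos_zero]
      ring
    rw [this]
    positivity
  -- At y = y₁ the tails carry all the mass and the central interval shrinks to a point.
  have hE1 : E y₁ < 0 := by
    obtain ⟨hm, ht⟩ := hZ y₁ ⟨h0.le, le_rfl⟩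
    have hz : Real.pi - Z y₁ = Real.pi :=
      tailMass_strictMonoOn.injOn ⟨by linarith [hm.2], by linarith [hm.1]⟩ ⟨hpi0.le, le_rfl⟩
        (by rw [ht, tailMass_pi]; ring)
    have hz0 : Z y₁ = 0 := by linarith
    have : E y₁ = 2 * tailCriterion y₁ := by
      simp only [E, hz0, Real.sin_zero, Real.cos_zero, tailCriterion, ← hκ]
      ring
    linarith
  obtain ⟨y, hy, hEy⟩ := intermediate_value_Ioo' h0.le hEc.continuousOn ⟨hE1, hE0⟩
  obtain ⟨hm, ht⟩ := hZ y ⟨hy.1.le, hy.2.le⟩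
  have hypi : y ∈ Set.Icc 0 Real.pi := ⟨hy.1.le, (hy.2.trans hpi).le⟩
  have hm' : Real.pi - Z y ∈ Set.Icc 0 Real.pi := ⟨by linarith [hm.2], by linarith [hm.1]⟩
  have hyκ : tailMass y < κ := tailMass_strictMonoOn hypi ⟨h0.le, hpi.le⟩ hy.2
  have hz1 := hlt hm' ⟨hpi0.le, le_rfl⟩ (by rw [ht, tailMass_pi]; linarith)
  -- Gives y < π − z, which is b < a.
  have hz2 := hlt hypi hm' (by rw [ht]; linarith)
  refine ⟨y, Z y, _, _, hy.1, by linarith, by linarith, ?_, rfl, rfl, sub_eq_zero.1 hEy⟩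
  rw [hmass] at ht
  linarith

/-! ### Moments and a sufficient condition for D-optimality -/

/-- The `k`-th moment of the design with density `f`. -/
noncomputable def designMoment (f : ℝ → ℝ) (k : ℕ) : ℝ := ∫ x, x ^ k * f x

lemma infoMatrix_apply (q : ℕ) (f : ℝ → ℝ) (i j : Fin (q + 1)) :
    infoMatrix q f i j = designMoment f (i + j) := by
  simp [infoMatrix, designMoment, regressionVector, Matrix.vecMulVec_apply, pow_add]

lemma infoMatrix_two_det (f : ℝ → ℝ) :
    (infoMatrix 2 f).det =
      designMoment f 2 * (designMoment f 0 * designMoment f 4 - designMoment f 2 ^ 2) -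
      (designMoment f 0 * designMoment f 3 ^ 2 -
        2 * designMoment f 1 * designMoment f 2 * designMoment f 3 +
        designMoment f 1 ^ 2 * designMoment f 4) := by
  rw [Matrix.det_fin_three]
  simp only [infoMatrix_apply]
  norm_num
  ring

lemma IsSubsamplingDesign.integrable_pow_mul {fX f : ℝ → ℝ} {α : ℝ} (h : IsSubsamplingDesign fX α f)
    {k : ℕ} (hX : Integrable fun x => x ^ k * fX x) : Integrable fun x => x ^ k * f x := by
  refine hX.mono ((measurable_id.pow_const k).mul h.measurable).aestronglyMeasurable ?_
  refine Filter.Eventually.of_forall fun x => ?_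
  rw [norm_mul, norm_mul, Real.norm_of_nonneg (h.nonneg x),
    Real.norm_of_nonneg ((h.nonneg x).trans (h.le x))]
  exact mul_le_mul_of_nonneg_left (h.le x) (norm_nonneg _)

lemma ae_quadratic_ne_zero {v : Fin 3 → ℝ} (hv : v ≠ 0) :
    ∀ᵐ x : ℝ, v 0 + v 1 * x + v 2 * x ^ 2 ≠ 0 := by
  let p : Polynomial ℝ := Polynomial.C (v 0) + Polynomial.C (v 1) * Polynomial.X +
    Polynomial.C (v 2) * Polynomial.X ^ 2
  have hp : p ≠ 0 := by
    intro h
    apply hv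
    have h0 : p.coeff 0 = 0 := by simp [h]
    have h1 : p.coeff 1 = 0 := by simp [h]
    have h2 : p.coeff 2 = 0 := by simp [h]
    simp [p, Polynomial.coeff_X, Polynomial.coeff_C] at h0 h1 h2
    ext i
    fin_cases i <;> simp [h0, h1, h2]
  have hfin : {x : ℝ | p.IsRoot x}.Finite := Polynomial.finite_setOfPred_isRoot hp
  have := (hfin.countable.ae_notMem volume)
  filter_upwards [this] with x hx h0
  apply hx
  simpa [p, Polynomial.IsRoot] using h0

section

variable {fX f : ℝ → ℝ} {α : ℝ}

/-- The form is ∫ (v₀ + v₁x + v₂x²)² f. Were it zero, `f` would vanish off the finitely many roots,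
contradicting its mass α > 0. -/
lemma IsSubsamplingDesign.quadratic_pos (h : IsSubsamplingDesign fX α f) (hα : 0 < α)
    (hX : ∀ k ≤ 4, Integrable fun x => x ^ k * fX x) {v : Fin 3 → ℝ} (hv : v ≠ 0) :
    0 < v 0 ^ 2 * designMoment f 0 + 2 * v 0 * v 1 * designMoment f 1 +
      (v 1 ^ 2 + 2 * v 0 * v 2) * designMoment f 2 + 2 * v 1 * v 2 * designMoment f 3 +
      v 2 ^ 2 * designMoment f 4 := by
  have hi : ∀ k ≤ 4, Integrable fun x => x ^ k * f x := fun k hk => h.integrable_pow_mul (hX k hk)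
  have i0 := (hi 0 (by norm_num)).const_mul (v 0 ^ 2)
  have i1 := (hi 1 (by norm_num)).const_mul (2 * v 0 * v 1)
  have i2 := (hi 2 (by norm_num)).const_mul (v 1 ^ 2 + 2 * v 0 * v 2)
  have i3 := (hi 3 (by norm_num)).const_mul (2 * v 1 * v 2)
  have i4 := (hi 4 (by norm_num)).const_mul (v 2 ^ 2)
  simp only [designMoment]
  rw [← integral_const_mul, ← integral_const_mul, ← integral_const_mul, ← integral_const_mul,
    ← integral_const_mul, ← integral_add i0 i1, ← integral_add (i0.fun_add i1) i2,
    ← integral_add ((i0.fun_add i1).fun_add i2) i3,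
    ← integral_add (((i0.fun_add i1).fun_add i2).fun_add i3) i4]
  have heq : ∀ x : ℝ, v 0 ^ 2 * (x ^ 0 * f x) + 2 * v 0 * v 1 * (x ^ 1 * f x) +
      (v 1 ^ 2 + 2 * v 0 * v 2) * (x ^ 2 * f x) + 2 * v 1 * v 2 * (x ^ 3 * f x) +
      v 2 ^ 2 * (x ^ 4 * f x) = (v 0 + v 1 * x + v 2 * x ^ 2) ^ 2 * f x := fun x => by ring
  have hint := (((i0.add i1).add i2).add i3).add i4
  have hint' : Integrable fun x => (v 0 + v 1 * x + v 2 * x ^ 2) ^ 2 * f x :=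
    hint.congr (Filter.Eventually.of_forall heq)
  rw [integral_congr_ae (Filter.Eventually.of_forall heq)]
  have hnn : 0 ≤ fun x => (v 0 + v 1 * x + v 2 * x ^ 2) ^ 2 * f x :=
    fun x => mul_nonneg (sq_nonneg _) (h.nonneg x)
  refine (integral_nonneg hnn).lt_of_ne' fun h0 => ?_
  rw [integral_eq_zero_iff_of_nonneg hnn hint'] at h0
  have hf0 : f =ᵐ[volume] 0 := by
    filter_upwards [h0, ae_quadratic_ne_zero hv] with x hx hne
    simpa [hne] using hx
  have := h.integral_eq
  rw [integral_congr_ae hf0] at this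
  simp at this
  linarith

lemma IsSubsamplingDesign.infoMatrix_posDef (h : IsSubsamplingDesign fX α f) (hα : 0 < α)
    (hX : ∀ k ≤ 4, Integrable fun x => x ^ k * fX x) : (infoMatrix 2 f).PosDef := by
  refine Matrix.PosDef.of_dotProduct_mulVec_pos ?_ fun v hv => ?_
  · ext i j
    simp [infoMatrix_apply, add_comm]
  · refine (h.quadratic_pos hα hX hv).trans_eq ?_
    simp [dotProduct, Matrix.mulVec, Fin.sum_univ_three, infoMatrix_apply]
    ring

lemma IsSubsamplingDesign.designMoment_zero (h : IsSubsamplingDesign fX α f) :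
    designMoment f 0 = α := by
  simpa [designMoment] using h.integral_eq

lemma IsSubsamplingDesign.det_bounds (h : IsSubsamplingDesign fX α f) (hα : 0 < α)
    (hX : ∀ k ≤ 4, Integrable fun x => x ^ k * fX x) :
    0 < designMoment f 2 ∧ 0 < α * designMoment f 4 - designMoment f 2 ^ 2 ∧
      0 < (infoMatrix 2 f).det ∧ (infoMatrix 2 f).det ≤
        designMoment f 2 * (α * designMoment f 4 - designMoment f 2 ^ 2) := by
  have h0 := h.designMoment_zero
  have h2 := h.quadratic_pos hα hX (v := ![0, 1, 0]) (by simp)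
  -- This test vector gives the value α(αm₄ − m₂²).
  have h4 := h.quadratic_pos hα hX (v := ![-designMoment f 2, 0, α]) (by simp [hα.ne'])
  simp at h2
  simp [h0] at h4
  have hD : 0 < α * designMoment f 4 - designMoment f 2 ^ 2 := by
    refine pos_of_mul_pos_right (a := α) ?_ hα.le
    linarith
  refine ⟨h2, hD, (h.infoMatrix_posDef hα hX).det_pos, ?_⟩
  rw [infoMatrix_two_det, h0]
  have : 0 ≤ α * designMoment f 3 ^ 2 -
        2 * designMoment f 1 * designMoment f 2 * designMoment f 3 +
        designMoment f 1 ^ 2 * designMoment f 4 := by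
    -- Times α, the odd-moment term is (αm₃ − m₁m₂)² + m₁²(αm₄ − m₂²).
    refine nonneg_of_mul_nonneg_right (a := α) ?_ hα
    have := mul_nonneg (sq_nonneg (designMoment f 1)) hD.le
    linarith [sq_nonneg (α * designMoment f 3 - designMoment f 1 * designMoment f 2)]
  linarith

lemma Real.log_le_log_add_div {x y : ℝ} (hx : 0 < x) (hy : 0 < y) :
    Real.log y ≤ Real.log x + (y - x) / x := by
  have := Real.log_le_sub_one_of_pos (div_pos hy hx)
  rw [Real.log_div hy.ne' hx.ne'] at this
  have e : (y - x) / x = y / x - 1 := by field_simp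
  linarith

/-- A sufficient condition for the `D`-optimality of a symmetric design in quadratic regression:
the design keeps the region where a biquadratic polynomial, matched to its moments, is
nonnegative. -/
lemma isTheDOptimalDensity_indicator {S : Set ℝ} {A B : ℝ} (hα : 0 < α)
    (hX : ∀ k ≤ 4, Integrable fun x => x ^ k * fX x)
    (hf : IsSubsamplingDesign fX α (S.indicator fX))
    (h1 : designMoment (S.indicator fX) 1 = 0) (h3 : designMoment (S.indicator fX) 3 = 0)
    (hS : ∀ x ∈ S, 0 ≤ (x ^ 2 - A) * (x ^ 2 - B))
    (hS' : ∀ x ∉ S, (x ^ 2 - A) * (x ^ 2 - B) ≤ 0)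
    (hAB : α * designMoment (S.indicator fX) 2 * (A + B) =
      3 * designMoment (S.indicator fX) 2 ^ 2 - α * designMoment (S.indicator fX) 4) :
    IsTheDOptimalDensity 2 fX α (S.indicator fX) := by
  set f := S.indicator fX with hfdef
  obtain ⟨hm2, hD, hdet, -⟩ := hf.det_bounds hα hX
  have hdetf : (infoMatrix 2 f).det =
      designMoment f 2 * (α * designMoment f 4 - designMoment f 2 ^ 2) := by
    rw [infoMatrix_two_det, h1, h3, hf.designMoment_zero]
    ring
  have hfi : ∀ k ≤ 4, Integrable fun x => x ^ k * f x := fun k hk => hf.integrable_pow_mul (hX k hk)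
  -- On S the design is at its upper bound, off S at its lower bound 0, so `f - g` has the sign of
  -- the biquadratic.
  have hpt : ∀ g, IsSubsamplingDesign fX α g → ∀ x,
      0 ≤ (x ^ 2 - A) * (x ^ 2 - B) * (f x - g x) := by
    intro g hg x
    by_cases hx : x ∈ S
    · rw [hfdef, Set.indicator_of_mem hx]
      exact mul_nonneg (hS x hx) (sub_nonneg.2 (hg.le x))
    · rw [hfdef, Set.indicator_of_notMem hx]
      have := mul_nonneg (neg_nonneg.2 (hS' x hx)) (hg.nonneg x)
      linarith
  have hint : ∀ g, IsSubsamplingDesign fX α g →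
      Integrable (fun x => (x ^ 2 - A) * (x ^ 2 - B) * (f x - g x)) ∧
      ∫ x, (x ^ 2 - A) * (x ^ 2 - B) * (f x - g x) =
        (designMoment f 4 - designMoment g 4) -
          (A + B) * (designMoment f 2 - designMoment g 2) := by
    intro g hg
    have hgi : ∀ k ≤ 4, Integrable fun x => x ^ k * g x :=
      fun k hk => hg.integrable_pow_mul (hX k hk)
    have i4 := (hfi 4 (by norm_num)).sub (hgi 4 (by norm_num))
    have i2 := ((hfi 2 (by norm_num)).sub (hgi 2 (by norm_num))).const_mul (A + B)
    have i0 := ((hfi 0 (by norm_num)).sub (hgi 0 (by norm_num))).const_mul (A * B)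
    have heq : ∀ x, (x ^ 4 * f x - x ^ 4 * g x) - (A + B) * (x ^ 2 * f x - x ^ 2 * g x) +
        A * B * (x ^ 0 * f x - x ^ 0 * g x) = (x ^ 2 - A) * (x ^ 2 - B) * (f x - g x) := by
      intro x; ring
    refine ⟨((i4.sub i2).add i0).congr (Filter.Eventually.of_forall heq), ?_⟩
    rw [← integral_congr_ae (Filter.Eventually.of_forall heq)]
    have e1 := integral_add (i4.sub i2) i0
    have e2 := integral_sub i4 i2
    simp only [Pi.sub_apply, integral_const_mul] at e1 e2
    rw [e1, e2, integral_sub (hfi 4 (by norm_num)) (hgi 4 (by norm_num)),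
      integral_sub (hfi 2 (by norm_num)) (hgi 2 (by norm_num)),
      integral_sub (hfi 0 (by norm_num)) (hgi 0 (by norm_num))]
    have z1 := hf.designMoment_zero
    have z2 := hg.designMoment_zero
    simp only [designMoment] at z1 z2 ⊢
    rw [z1, z2]
    ring
  -- Tangent bounds for the logarithms of m₂ and αm₄ − m₂². The condition on A + B turns their sum
  -- into a multiple of the biquadratic integral.
  have hbound : ∀ g, IsSubsamplingDesign fX α g → dCriterion 2 g ≤ dCriterion 2 f -
      α / (α * designMoment f 4 - designMoment f 2 ^ 2) *
        ∫ x, (x ^ 2 - A) * (x ^ 2 - B) * (f x - g x) := by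
    intro g hg
    obtain ⟨gm2, gD, gdet, gle⟩ := hg.det_bounds hα hX
    rw [(hint g hg).2, dCriterion, dCriterion, hdetf, Real.log_mul hm2.ne' hD.ne']
    have l1 := Real.log_le_log gdet gle
    rw [Real.log_mul gm2.ne' gD.ne'] at l1
    have l2 := Real.log_le_log_add_div hm2 gm2
    have l3 := Real.log_le_log_add_div hD gD
    -- Linearizing −m₂² at `f` discards the square of the difference of the second moments.
    have l4 : (α * designMoment g 4 - designMoment g 2 ^ 2 -
        (α * designMoment f 4 - designMoment f 2 ^ 2)) /
          (α * designMoment f 4 - designMoment f 2 ^ 2) ≤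
        (α * (designMoment g 4 - designMoment f 4) -
          2 * designMoment f 2 * (designMoment g 2 - designMoment f 2)) /
          (α * designMoment f 4 - designMoment f 2 ^ 2) := by
      apply div_le_div_of_nonneg_right _ hD.le
      linarith [sq_nonneg (designMoment g 2 - designMoment f 2)]
    have l5 : (designMoment g 2 - designMoment f 2) / designMoment f 2 +
        (α * (designMoment g 4 - designMoment f 4) -
          2 * designMoment f 2 * (designMoment g 2 - designMoment f 2)) /
          (α * designMoment f 4 - designMoment f 2 ^ 2) =
        -(α / (α * designMoment f 4 - designMoment f 2 ^ 2) *
          ((designMoment f 4 - designMoment g 4) -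
            (A + B) * (designMoment f 2 - designMoment g 2))) := by
      have hAB' : A + B = (3 * designMoment f 2 ^ 2 - α * designMoment f 4) /
          (α * designMoment f 2) := by
        rw [eq_div_iff (by positivity)]; linarith
      rw [hAB']
      have := hD.ne'
      have := hα.ne'
      have := hm2.ne'
      field_simp
      ring
    linarith
  have hΓ : 0 < α / (α * designMoment f 4 - designMoment f 2 ^ 2) := by positivity
  refine ⟨⟨hf, fun g hg => ?_⟩, fun g hg => ?_⟩
  · have := mul_nonneg hΓ.le (integral_nonneg (μ := volume) (hpt g hg))
    linarith [hbound g hg]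
  · have hb := hbound g hg.1
    have hge := hg.2 f hf
    -- For another optimal `g` the bound leaves no slack, so the nonnegative integrand vanishes
    -- almost everywhere.
    have h0 : ∫ x, (x ^ 2 - A) * (x ^ 2 - B) * (f x - g x) = 0 := by
      refine le_antisymm ?_ (integral_nonneg (hpt g hg.1))
      by_contra! hlt
      have := mul_pos hΓ hlt
      linarith
    rw [integral_eq_zero_iff_of_nonneg (hpt g hg.1) (hint g hg.1).1] at h0
    have hne : ∀ C : ℝ, ∀ᵐ x : ℝ, x ^ 2 - C ≠ 0 := by
      intro C
      filter_upwards [ae_quadratic_ne_zero (v := ![-C, 0, 1]) (by simp)] with x hx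
      simpa [sub_eq_neg_add] using hx
    filter_upwards [h0, hne A, hne B] with x hx hA hB
    have : f x - g x = 0 := by simpa [hA, hB] using hx
    linarith

end

/-! ### The t₅ density and its truncated moments -/

lemma studentTPDF_five (x : ℝ) :
    studentTPDF 5 x = 8 / (3 * Real.pi * Real.sqrt 5) * ((1 + x ^ 2 / 5) ^ 3)⁻¹ := by
  have h3 : Real.Gamma ((5 + 1) / 2) = 2 := by
    have := Real.Gamma_nat_eq_factorial 2
    norm_num at this ⊢
  have h52 : Real.Gamma (5 / 2) = 3 / 4 * Real.sqrt Real.pi := by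
    rw [show (5 / 2 : ℝ) = (1 / 2 + 1) + 1 by norm_num, Real.Gamma_add_one (by norm_num),
      Real.Gamma_add_one (by norm_num), Real.Gamma_one_half_eq]
    ring
  have hpow : (1 + x ^ 2 / 5) ^ (-((5 + 1) / 2) : ℝ) = ((1 + x ^ 2 / 5) ^ 3)⁻¹ := by
    rw [Real.rpow_neg (by positivity), ← Real.rpow_natCast]
    norm_num
  rw [studentTPDF, h3, h52, hpow, Real.sqrt_mul (by norm_num)]
  congr 1
  have hpi := Real.pi_pos
  have hs := Real.mul_self_sqrt hpi.le
  rw [div_eq_div_iff (by positivity) (by positivity)]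
  linear_combination (-6 * Real.sqrt 5) * hs

lemma studentTPDF_five_pos (x : ℝ) : 0 < studentTPDF 5 x := by
  rw [studentTPDF_five]
  have := Real.pi_pos
  positivity

lemma studentTPDF_five_neg (x : ℝ) : studentTPDF 5 (-x) = studentTPDF 5 x := by
  simp [studentTPDF_five]

lemma studentTPDF_five_continuous : Continuous (studentTPDF 5) := by
  have : studentTPDF 5 = fun x => 8 / (3 * Real.pi * Real.sqrt 5) * ((1 + x ^ 2 / 5) ^ 3)⁻¹ :=
    funext studentTPDF_five
  rw [this]
  refine continuous_const.mul (Continuous.inv₀ (by fun_prop) fun x => ?_)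
  positivity

lemma integrable_pow_mul_studentTPDF_five {k : ℕ} (hk : k ≤ 4) :
    Integrable fun x => x ^ k * studentTPDF 5 x := by
  refine (integrable_inv_one_add_sq.const_mul
    (125 * (8 / (3 * Real.pi * Real.sqrt 5)))).mono'
    ((continuous_pow k).mul studentTPDF_five_continuous).aestronglyMeasurable
    (Filter.Eventually.of_forall fun x => ?_)
  rw [norm_mul, Real.norm_of_nonneg (studentTPDF_five_pos x).le, studentTPDF_five, norm_pow,
    Real.norm_eq_abs]
  have hC : 0 < 8 / (3 * Real.pi * Real.sqrt 5) := by
    have := Real.pi_pos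
    positivity
  -- The constants 25 and 125 are powers of the 5 in 1 + x² ≤ 5(1 + x²/5).
  have hpow : |x| ^ k ≤ 25 * (1 + x ^ 2 / 5) ^ 2 := by
    have h4 : |x| ^ k ≤ (1 + x ^ 2) ^ 2 := by
      rcases le_total |x| 1 with h | h
      · exact (pow_le_one₀ (abs_nonneg x) h).trans (one_le_pow₀ (by nlinarith [sq_nonneg x]))
      · refine (pow_le_pow_right₀ h hk).trans ?_
        rw [← sq_abs x]
        nlinarith [sq_nonneg |x|]
    nlinarith [sq_nonneg x, sq_nonneg (x ^ 2)]
  have h1 : 0 < 1 + x ^ 2 / 5 := by positivity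
  have key : |x| ^ k * ((1 + x ^ 2 / 5) ^ 3)⁻¹ ≤ 125 * (1 + x ^ 2)⁻¹ := by
    rw [← div_eq_mul_inv, ← div_eq_mul_inv, div_le_div_iff₀ (by positivity) (by positivity)]
    calc |x| ^ k * (1 + x ^ 2) ≤ 25 * (1 + x ^ 2 / 5) ^ 2 * (5 * (1 + x ^ 2 / 5)) := by
          gcongr
          nlinarith [sq_nonneg x]
      _ = 125 * (1 + x ^ 2 / 5) ^ 3 := by ring
  calc _ = 8 / (3 * Real.pi * Real.sqrt 5) * (|x| ^ k * ((1 + x ^ 2 / 5) ^ 3)⁻¹) := by ring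
    _ ≤ 8 / (3 * Real.pi * Real.sqrt 5) * (125 * (1 + x ^ 2)⁻¹) := by gcongr
    _ = _ := by ring

/-- The antiderivatives of the functions `u ^ k / (1 + u ^ 2) ^ 3` for even `k ≤ 4`. -/
noncomputable def rationalPrimitive (p q r u : ℝ) : ℝ :=
  p * (u / (1 + u ^ 2) ^ 2) + q * (u / (1 + u ^ 2)) + r * Real.arctan u

lemma hasDerivAt_rationalPrimitive (p q r u : ℝ) :
    HasDerivAt (rationalPrimitive p q r)
      ((p * (1 - 3 * u ^ 2) + q * (1 - u ^ 4) + r * (1 + u ^ 2) ^ 2) / (1 + u ^ 2) ^ 3) u := by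
  have hne : (1 + u ^ 2) ≠ 0 := by positivity
  have h0 := hasDerivAt_id' u
  have h1 : HasDerivAt (fun u : ℝ => 1 + u ^ 2) (2 * u) u :=
    ((h0.fun_pow 2).const_add 1).congr_deriv (by norm_num)
  have h2 := (h0.fun_div (h1.fun_pow 2) (pow_ne_zero 2 hne)).const_mul p
  have h3 := (h0.fun_div h1 hne).const_mul q
  have h4 := (Real.hasDerivAt_arctan u).const_mul r
  refine ((h2.fun_add h3).fun_add h4).congr_deriv ?_
  field_simp
  norm_num
  ring

lemma rationalPrimitive_neg (p q r u : ℝ) :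
    rationalPrimitive p q r (-u) = -rationalPrimitive p q r u := by
  simp [rationalPrimitive, Real.arctan_neg]
  ring

lemma tendsto_rationalPrimitive_atTop (p q r : ℝ) :
    Filter.Tendsto (rationalPrimitive p q r) Filter.atTop (nhds (r * (Real.pi / 2))) := by
  have h1 : Filter.Tendsto (fun u : ℝ => u / (1 + u ^ 2)) Filter.atTop (nhds 0) := by
    refine squeeze_zero' (g := fun u : ℝ => u⁻¹) ?_ ?_ tendsto_inv_atTop_zero
    · filter_upwards [Filter.eventually_gt_atTop 0] with u hu
      positivity
    · filter_upwards [Filter.eventually_gt_atTop 0] with u hu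
      rw [← one_div, div_le_div_iff₀ (by positivity) hu]
      nlinarith
  have h2 : Filter.Tendsto (fun u : ℝ => u / (1 + u ^ 2) ^ 2) Filter.atTop (nhds 0) := by
    refine squeeze_zero' (g := fun u : ℝ => u / (1 + u ^ 2)) ?_ ?_ h1
    · filter_upwards [Filter.eventually_gt_atTop 0] with u hu
      positivity
    · filter_upwards [Filter.eventually_gt_atTop 0] with u hu
      gcongr
      nlinarith [sq_nonneg u, sq_nonneg (u ^ 2)]
  have h3 := tendsto_nhds_of_tendsto_nhdsWithin Real.tendsto_arctan_atTop
  have := ((h2.const_mul p).add (h1.const_mul q)).add (h3.const_mul r)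
  simp only [mul_zero, zero_add] at this
  exact this

lemma tendsto_rationalPrimitive_atBot (p q r : ℝ) :
    Filter.Tendsto (rationalPrimitive p q r) Filter.atBot (nhds (-(r * (Real.pi / 2)))) := by
  have := ((tendsto_rationalPrimitive_atTop p q r).comp Filter.tendsto_neg_atBot_atTop).neg
  refine this.congr fun u => ?_
  simp [rationalPrimitive_neg]

/-- Under the half-angle substitution, 1/(1 + u²) = cos²(w/2) and the arctangent becomes w/2; hence
the moments are elementary in the angle. -/
lemma rationalPrimitive_tan (p q r : ℝ) {w : ℝ} (h : -Real.pi < w) (h' : w < Real.pi) :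
    rationalPrimitive p q r (Real.tan (w / 2)) =
      p * (Real.sin w * (1 + Real.cos w) / 4) + q * (Real.sin w / 2) + r * (w / 2) := by
  have hc : 0 < Real.cos (w / 2) := Real.cos_pos_of_mem_Ioo ⟨by linarith, by linarith⟩
  have hw : w = 2 * (w / 2) := by ring
  have hsq := Real.sin_sq_add_cos_sq (w / 2)
  rw [rationalPrimitive, Real.arctan_tan (by linarith) (by linarith), Real.tan_eq_sin_div_cos]
  have hs : Real.sin w = 2 * Real.sin (w / 2) * Real.cos (w / 2) := by
    rw [← Real.sin_two_mul]; congr 1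
  have hcw : Real.cos w = 2 * Real.cos (w / 2) ^ 2 - 1 := by
    rw [← Real.cos_two_mul]; congr 1
  have e : 1 + (Real.sin (w / 2) / Real.cos (w / 2)) ^ 2 = (Real.cos (w / 2) ^ 2)⁻¹ := by
    field_simp
    linarith
  rw [e, hs, hcw]
  field_simp
  ring

lemma tan_half_sq {w : ℝ} (h : -Real.pi < w) (h' : w < Real.pi) :
    Real.tan (w / 2) ^ 2 * (1 + Real.cos w) = 1 - Real.cos w := by
  have hc : 0 < Real.cos (w / 2) := Real.cos_pos_of_mem_Ioo ⟨by linarith, by linarith⟩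
  have hcw : Real.cos w = 2 * Real.cos (w / 2) ^ 2 - 1 := by
    rw [← Real.cos_two_mul]; congr 1; ring
  have hsq := Real.sin_sq_add_cos_sq (w / 2)
  rw [Real.tan_eq_sin_div_cos, hcw]
  field_simp
  linear_combination 2 * Real.cos (w / 2) ^ 2 * hsq

/-- The hypothesis writes u^k through the three numerators in the derivative of `rationalPrimitive`.
The power of √5 comes from the scaling x = √5 u. -/
lemma hasDerivAt_studentPrimitive {k : ℕ} {p q r : ℝ}
    (hpqr : ∀ u : ℝ, u ^ k = p * (1 - 3 * u ^ 2) + q * (1 - u ^ 4) + r * (1 + u ^ 2) ^ 2) (x : ℝ) :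
    HasDerivAt (fun x => 8 / (3 * Real.pi) * Real.sqrt 5 ^ k *
      rationalPrimitive p q r (x / Real.sqrt 5)) (x ^ k * studentTPDF 5 x) x := by
  have h5 : 0 < Real.sqrt 5 := by positivity
  have h5' : Real.sqrt 5 ^ 2 = 5 := Real.sq_sqrt (by norm_num)
  have h := ((hasDerivAt_rationalPrimitive p q r (x / Real.sqrt 5)).comp x
    ((hasDerivAt_id' x).div_const (Real.sqrt 5))).const_mul (8 / (3 * Real.pi) * Real.sqrt 5 ^ k)
  refine h.congr_deriv ?_
  rw [← hpqr, studentTPDF_five, div_pow, div_pow, h5']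
  have := Real.pi_pos
  field_simp

lemma tendsto_studentPrimitive_atTop (k : ℕ) (p q r : ℝ) :
    Filter.Tendsto (fun x => 8 / (3 * Real.pi) * Real.sqrt 5 ^ k *
      rationalPrimitive p q r (x / Real.sqrt 5)) Filter.atTop
      (nhds (8 / (3 * Real.pi) * Real.sqrt 5 ^ k * (r * (Real.pi / 2)))) :=
  ((tendsto_rationalPrimitive_atTop p q r).comp
    (Filter.tendsto_id.atTop_div_const (by positivity))).const_mul _

lemma tendsto_studentPrimitive_atBot (k : ℕ) (p q r : ℝ) :
    Filter.Tendsto (fun x => 8 / (3 * Real.pi) * Real.sqrt 5 ^ k *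
      rationalPrimitive p q r (x / Real.sqrt 5)) Filter.atBot
      (nhds (8 / (3 * Real.pi) * Real.sqrt 5 ^ k * (-(r * (Real.pi / 2))))) :=
  ((tendsto_rationalPrimitive_atBot p q r).comp
    (Filter.tendsto_id.atBot_div_const (by positivity))).const_mul _

section

variable {k : ℕ} {p q r : ℝ}

lemma setIntegral_Iic_studentTPDF_five (hk : k ≤ 4)
    (hpqr : ∀ u : ℝ, u ^ k = p * (1 - 3 * u ^ 2) + q * (1 - u ^ 4) + r * (1 + u ^ 2) ^ 2) (u : ℝ) :
    ∫ x in Set.Iic (Real.sqrt 5 * u), x ^ k * studentTPDF 5 x =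
      8 / (3 * Real.pi) * Real.sqrt 5 ^ k * (r * (Real.pi / 2) + rationalPrimitive p q r u) := by
  rw [integral_Iic_of_hasDerivAt_of_tendsto' (fun x _ => hasDerivAt_studentPrimitive hpqr x)
    (integrable_pow_mul_studentTPDF_five hk).integrableOn (tendsto_studentPrimitive_atBot k p q r),
    mul_div_cancel_left₀ _ (by positivity)]
  ring

lemma setIntegral_Ici_studentTPDF_five (hk : k ≤ 4)
    (hpqr : ∀ u : ℝ, u ^ k = p * (1 - 3 * u ^ 2) + q * (1 - u ^ 4) + r * (1 + u ^ 2) ^ 2) (u : ℝ) :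
    ∫ x in Set.Ici (Real.sqrt 5 * u), x ^ k * studentTPDF 5 x =
      8 / (3 * Real.pi) * Real.sqrt 5 ^ k * (r * (Real.pi / 2) - rationalPrimitive p q r u) := by
  rw [integral_Ici_eq_integral_Ioi,
    integral_Ioi_of_hasDerivAt_of_tendsto' (fun x _ => hasDerivAt_studentPrimitive hpqr x)
    (integrable_pow_mul_studentTPDF_five hk).integrableOn (tendsto_studentPrimitive_atTop k p q r),
    mul_div_cancel_left₀ _ (by positivity)]
  ring

lemma setIntegral_Icc_studentTPDF_five (hk : k ≤ 4)
    (hpqr : ∀ u : ℝ, u ^ k = p * (1 - 3 * u ^ 2) + q * (1 - u ^ 4) + r * (1 + u ^ 2) ^ 2)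
    {v : ℝ} (hv : 0 ≤ v) :
    ∫ x in Set.Icc (-(Real.sqrt 5 * v)) (Real.sqrt 5 * v), x ^ k * studentTPDF 5 x =
      2 * (8 / (3 * Real.pi)) * Real.sqrt 5 ^ k * rationalPrimitive p q r v := by
  have h5 : 0 ≤ Real.sqrt 5 * v := by positivity
  rw [integral_Icc_eq_integral_Ioc, ← intervalIntegral.integral_of_le (by linarith),
    intervalIntegral.integral_eq_sub_of_hasDerivAt
      (fun x _ => hasDerivAt_studentPrimitive hpqr x)
      (integrable_pow_mul_studentTPDF_five hk).intervalIntegrable,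
    neg_div, mul_div_cancel_left₀ _ (by positivity), rationalPrimitive_neg]
  ring

lemma designMoment_indicator {S : Set ℝ} (hS : MeasurableSet S) (f : ℝ → ℝ) (k : ℕ) :
    designMoment (S.indicator f) k = ∫ x in S, x ^ k * f x := by
  rw [designMoment, ← integral_indicator hS]
  congr 1
  ext x
  by_cases hx : x ∈ S <;> simp [hx]

lemma designMoment_tails (hk : k ≤ 4)
    (hpqr : ∀ u : ℝ, u ^ k = p * (1 - 3 * u ^ 2) + q * (1 - u ^ 4) + r * (1 + u ^ 2) ^ 2)
    {u : ℝ} (hu : 0 < u) :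
    designMoment ((Set.Iic (-(Real.sqrt 5 * u)) ∪ Set.Ici (Real.sqrt 5 * u)).indicator
      (studentTPDF 5)) k = 2 * (8 / (3 * Real.pi)) * Real.sqrt 5 ^ k *
        (r * (Real.pi / 2) - rationalPrimitive p q r u) := by
  have h5 : 0 < Real.sqrt 5 * u := by positivity
  have hi := integrable_pow_mul_studentTPDF_five hk
  have hl := setIntegral_Iic_studentTPDF_five hk hpqr (-u)
  rw [mul_neg] at hl
  rw [designMoment_indicator (measurableSet_Iic.union measurableSet_Ici),
    setIntegral_union (Set.Iic_disjoint_Ici.2 (by linarith)) measurableSet_Ici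
      hi.integrableOn hi.integrableOn, hl,
    setIntegral_Ici_studentTPDF_five hk hpqr, rationalPrimitive_neg]
  ring

lemma designMoment_tails_union_Icc (hk : k ≤ 4)
    (hpqr : ∀ u : ℝ, u ^ k = p * (1 - 3 * u ^ 2) + q * (1 - u ^ 4) + r * (1 + u ^ 2) ^ 2)
    {u v : ℝ} (hv : 0 ≤ v) (huv : v < u) :
    designMoment ((Set.Iic (-(Real.sqrt 5 * u)) ∪ Set.Icc (-(Real.sqrt 5 * v)) (Real.sqrt 5 * v) ∪
      Set.Ici (Real.sqrt 5 * u)).indicator (studentTPDF 5)) k =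
        2 * (8 / (3 * Real.pi)) * Real.sqrt 5 ^ k *
          (r * (Real.pi / 2) - rationalPrimitive p q r u + rationalPrimitive p q r v) := by
  have h5 : Real.sqrt 5 * v < Real.sqrt 5 * u := by gcongr
  have h5' : 0 ≤ Real.sqrt 5 * v := by positivity
  have hi := integrable_pow_mul_studentTPDF_five hk
  have hl := setIntegral_Iic_studentTPDF_five hk hpqr (-u)
  rw [mul_neg] at hl
  have hd1 : Disjoint (Set.Iic (-(Real.sqrt 5 * u)))
      (Set.Icc (-(Real.sqrt 5 * v)) (Real.sqrt 5 * v)) :=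
    Set.disjoint_left.2 fun x h1 h2 => by linarith [h1.out, h2.1]
  have hd2 : Disjoint (Set.Iic (-(Real.sqrt 5 * u)) ∪
      Set.Icc (-(Real.sqrt 5 * v)) (Real.sqrt 5 * v)) (Set.Ici (Real.sqrt 5 * u)) :=
    Set.disjoint_left.2 fun x h1 h2 => by
      rcases h1 with h1 | h1
      · linarith [h1.out, h2.out]
      · linarith [h1.2, h2.out]
  rw [designMoment_indicator ((measurableSet_Iic.union measurableSet_Icc).union measurableSet_Ici),
    setIntegral_union hd2 measurableSet_Ici hi.integrableOn hi.integrableOn,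
    setIntegral_union hd1 measurableSet_Icc hi.integrableOn hi.integrableOn, hl,
    setIntegral_Ici_studentTPDF_five hk hpqr, setIntegral_Icc_studentTPDF_five hk hpqr hv,
    rationalPrimitive_neg]
  ring

end

lemma designMoment_odd {S : Set ℝ} (hS : ∀ x, -x ∈ S ↔ x ∈ S) {k : ℕ} (hk : Odd k) :
    designMoment (S.indicator (studentTPDF 5)) k = 0 := by
  have h := integral_neg_eq_self (fun x => x ^ k * S.indicator (studentTPDF 5) x) volume
  have e : ∀ x, S.indicator (studentTPDF 5) (-x) = S.indicator (studentTPDF 5) x := by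
    intro x
    by_cases hx : x ∈ S <;> simp [hx, hS, studentTPDF_five_neg]
  simp only [hk.neg_pow, e, neg_mul, integral_neg] at h
  rw [designMoment]
  linarith

lemma isSubsamplingDesign_indicator {S : Set ℝ} (hS : MeasurableSet S) :
    IsSubsamplingDesign (studentTPDF 5) (designMoment (S.indicator (studentTPDF 5)) 0)
      (S.indicator (studentTPDF 5)) where
  measurable := studentTPDF_five_continuous.measurable.indicator hS
  nonneg x := Set.indicator_nonneg (fun x _ => (studentTPDF_five_pos x).le) x
  le x := Set.indicator_le_self' (fun x _ => (studentTPDF_five_pos x).le) x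
  integrable := by
    have := integrable_pow_mul_studentTPDF_five (k := 0) (by norm_num)
    simp only [pow_zero, one_mul] at this
    exact this.indicator hS
  integral_eq := by simp [designMoment]

/-- The three numerators form a basis of the even polynomials of degree at most 4; comparing
coefficients gives the values here and for `u ^ 2` and `u ^ 4`. -/
lemma pow_zero_decomp (u : ℝ) :
    u ^ 0 = 1 / 4 * (1 - 3 * u ^ 2) + 3 / 8 * (1 - u ^ 4) + 3 / 8 * (1 + u ^ 2) ^ 2 := by ring

lemma pow_two_decomp (u : ℝ) :
    u ^ 2 = -1 / 4 * (1 - 3 * u ^ 2) + 1 / 8 * (1 - u ^ 4) + 1 / 8 * (1 + u ^ 2) ^ 2 := by ring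

lemma pow_four_decomp (u : ℝ) :
    u ^ 4 = 1 / 4 * (1 - 3 * u ^ 2) + -5 / 8 * (1 - u ^ 4) + 3 / 8 * (1 + u ^ 2) ^ 2 := by ring

lemma rationalPrimitive_tan_pi_sub (p q r : ℝ) {y : ℝ} (h0 : 0 < y) (hpi : y < Real.pi) :
    rationalPrimitive p q r (Real.tan ((Real.pi - y) / 2)) =
      p * (Real.sin y * (1 - Real.cos y) / 4) + q * (Real.sin y / 2) +
        r * ((Real.pi - y) / 2) := by
  rw [rationalPrimitive_tan _ _ _ (by linarith) (by linarith), Real.sin_pi_sub, Real.cos_pi_sub]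
  ring

/-! ### Quantiles of the t₅ distribution -/

lemma measureReal_Iic_studentTMeasure (x : ℝ) :
    (studentTMeasure 5).real (Set.Iic x) = ∫ t in Set.Iic x, studentTPDF 5 t := by
  have hi := integrable_pow_mul_studentTPDF_five (k := 0) (by norm_num)
  simp only [pow_zero, one_mul] at hi
  rw [Measure.real, studentTMeasure, withDensity_apply _ measurableSet_Iic,
    ← ofReal_integral_eq_lintegral_ofReal hi.integrableOn
      (Filter.Eventually.of_forall fun x => (studentTPDF_five_pos x).le),
    ENNReal.toReal_ofReal (integral_nonneg fun x => (studentTPDF_five_pos x).le)]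

lemma quantile_eq_of_strictMono {μ : Measure ℝ} {p a : ℝ}
    (hmono : StrictMono fun x => μ.real (Set.Iic x)) (ha : μ.real (Set.Iic a) = p) :
    quantile μ p = a := by
  have : {x : ℝ | p ≤ μ.real (Set.Iic x)} = Set.Ici a := by
    ext x
    simp only [Set.mem_ofPred_eq, Set.mem_Ici, ← ha]
    exact hmono.le_iff_le
  rw [quantile, this, csInf_Ici]

lemma measureReal_Iic_studentTMeasure_eq (x : ℝ) :
    (studentTMeasure 5).real (Set.Iic x) = 8 / (3 * Real.pi) * Real.sqrt 5 ^ 0 *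
      (3 / 8 * (Real.pi / 2) + rationalPrimitive (1 / 4) (3 / 8) (3 / 8) (x / Real.sqrt 5)) := by
  rw [measureReal_Iic_studentTMeasure, ← setIntegral_Iic_studentTPDF_five (by norm_num)
    pow_zero_decomp, mul_div_cancel₀ _ (by positivity)]
  simp

lemma strictMono_measureReal_Iic_studentTMeasure :
    StrictMono fun x => (studentTMeasure 5).real (Set.Iic x) := by
  have h : StrictMono fun x => 8 / (3 * Real.pi) * Real.sqrt 5 ^ 0 *
      rationalPrimitive (1 / 4) (3 / 8) (3 / 8) (x / Real.sqrt 5) := by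
    apply strictMono_of_deriv_pos
    intro x
    rw [(hasDerivAt_studentPrimitive pow_zero_decomp x).deriv]
    simpa using studentTPDF_five_pos x
  intro x y hxy
  have := h hxy
  simp only [measureReal_Iic_studentTMeasure_eq, mul_add] at this ⊢
  linarith

/-- By symmetry each tail has half of the mass `tailMass y / (3 * π)`, and strict monotonicity of
the distribution function makes the solution unique. -/
lemma quantile_studentTMeasure {y : ℝ} (h0 : 0 < y) (hpi : y < Real.pi) :
    quantile (studentTMeasure 5) (1 - tailMass y / (3 * Real.pi) / 2) =
      Real.sqrt 5 * Real.tan ((Real.pi - y) / 2) := by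
  apply quantile_eq_of_strictMono strictMono_measureReal_Iic_studentTMeasure
  rw [measureReal_Iic_studentTMeasure_eq, mul_div_cancel_left₀ _ (by positivity),
    rationalPrimitive_tan_pi_sub _ _ _ h0 hpi, tailMass]
  have := Real.pi_pos
  field_simp
  ring

/-! ### Optimality of the two kinds of design -/

lemma neg_mem_tails (a x : ℝ) :
    -x ∈ Set.Iic (-a) ∪ Set.Ici a ↔ x ∈ Set.Iic (-a) ∪ Set.Ici a := by
  simp only [Set.mem_union, Set.mem_Iic, Set.mem_Ici, neg_le_neg_iff]
  rw [or_comm, le_neg]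

lemma neg_mem_tails_union_Icc (a b x : ℝ) :
    -x ∈ Set.Iic (-a) ∪ Set.Icc (-b) b ∪ Set.Ici a ↔
      x ∈ Set.Iic (-a) ∪ Set.Icc (-b) b ∪ Set.Ici a := by
  simp only [Set.mem_union, Set.mem_Iic, Set.mem_Ici, Set.mem_Icc, neg_le_neg_iff]
  constructor <;> rintro ((h | h) | h)
  · exact Or.inr h
  · exact Or.inl (Or.inr ⟨by linarith, by linarith⟩)
  · exact Or.inl (Or.inl (by linarith))
  · exact Or.inr (by linarith)
  · exact Or.inl (Or.inr ⟨by linarith, by linarith⟩)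
  · exact Or.inl (Or.inl h)

lemma cos_mem_Ioo {y : ℝ} (h0 : 0 < y) (hpi : y < Real.pi) : Real.cos y ∈ Set.Ioo (-1) 1 := by
  have hs := Real.sin_pos_of_pos_of_lt_pi h0 hpi
  have := Real.sin_sq_add_cos_sq y
  constructor <;> nlinarith

lemma sq_le_sq_of_le_neg {a x : ℝ} (ha : 0 ≤ a) (hx : x ≤ -a) : a ^ 2 ≤ x ^ 2 := by
  rw [← neg_sq x]
  exact pow_le_pow_left₀ ha (le_neg.1 hx) 2

/-- Take for A the squared threshold; the moments then force B. If B ≤ 0, the factor x² − B is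
nonnegative everywhere and the biquadratic changes sign only at the threshold. -/
lemma isTheDOptimalDensity_tails {y : ℝ} (h0 : 0 < y) (hpi : y < Real.pi)
    (hy : 0 ≤ tailCriterion y) :
    IsTheDOptimalDensity 2 (studentTPDF 5) (tailMass y / (3 * Real.pi))
      ((Set.Iic (-(Real.sqrt 5 * Real.tan ((Real.pi - y) / 2))) ∪
        Set.Ici (Real.sqrt 5 * Real.tan ((Real.pi - y) / 2))).indicator (studentTPDF 5)) := by
  have hpi0 := Real.pi_pos
  have h5 : Real.sqrt 5 ^ 2 = 5 := Real.sq_sqrt (by norm_num)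
  have h54 : Real.sqrt 5 ^ 4 = 25 := by linear_combination (Real.sqrt 5 ^ 2 + 5) * h5
  have hu : 0 < Real.tan ((Real.pi - y) / 2) :=
    Real.tan_pos_of_pos_of_lt_pi_div_two (by linarith) (by linarith)
  have m0 := designMoment_tails (by norm_num) pow_zero_decomp hu
  have m2 := designMoment_tails (by norm_num) pow_two_decomp hu
  have m4 := designMoment_tails (by norm_num) pow_four_decomp hu
  rw [rationalPrimitive_tan_pi_sub _ _ _ h0 hpi] at m0 m2 m4
  have hu2 := tan_half_sq (w := Real.pi - y) (by linarith) (by linarith)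
  rw [Real.cos_pi_sub] at hu2
  obtain ⟨hc1, hc2⟩ := cos_mem_Ioo h0 hpi
  have hα0 : 0 < tailMass y := by
    rw [← tailMass_zero]
    exact tailMass_strictMonoOn ⟨le_rfl, hpi0.le⟩ ⟨h0.le, hpi.le⟩ h0
  have hq0 := sub_sin_mul_cos_pos h0
  set u := Real.tan ((Real.pi - y) / 2)
  set S := Set.Iic (-(Real.sqrt 5 * u)) ∪ Set.Ici (Real.sqrt 5 * u) with hS
  have m0' : designMoment (S.indicator (studentTPDF 5)) 0 = tailMass y / (3 * Real.pi) := by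
    rw [m0, tailMass]; field_simp; ring
  have m2' : designMoment (S.indicator (studentTPDF 5)) 2 =
      5 * (y - Real.sin y * Real.cos y) / (3 * Real.pi) := by
    rw [m2, h5]; field_simp; ring
  have m4' : designMoment (S.indicator (studentTPDF 5)) 4 =
      25 * (3 * y + 4 * Real.sin y + Real.sin y * Real.cos y) / (3 * Real.pi) := by
    rw [m4, h54]; field_simp; ring
  have hf := isSubsamplingDesign_indicator
    ((measurableSet_Iic.union measurableSet_Ici : MeasurableSet S))
  rw [m0'] at hf
  -- The fraction is (A + B)/5. Multiplied by 1 − cos y, with u²(1 − cos y) = 1 + cos y, this is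
  -- nonnegativity of the criterion, and it says B ≤ 0.
  have hβ : (3 * (y - Real.sin y * Real.cos y) ^ 2 - tailMass y *
      (3 * y + 4 * Real.sin y + Real.sin y * Real.cos y)) /
        (tailMass y * (y - Real.sin y * Real.cos y)) ≤ u ^ 2 := by
    have hcc : 0 < 1 - Real.cos y := by linarith
    rw [div_le_iff₀ (by positivity)]
    rw [tailCriterion] at hy
    refine le_of_mul_le_mul_right ?_ hcc
    have e : u ^ 2 * (tailMass y * (y - Real.sin y * Real.cos y)) * (1 - Real.cos y) =
      tailMass y * (y - Real.sin y * Real.cos y) * (1 + Real.cos y) := by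
      linear_combination (tailMass y * (y - Real.sin y * Real.cos y)) * hu2
    rw [e]
    linarith
  set β := (3 * (y - Real.sin y * Real.cos y) ^ 2 - tailMass y *
      (3 * y + 4 * Real.sin y + Real.sin y * Real.cos y)) /
        (tailMass y * (y - Real.sin y * Real.cos y)) with hβdef
  refine isTheDOptimalDensity_indicator (A := 5 * u ^ 2) (B := 5 * (β - u ^ 2)) (by positivity)
    (fun k hk => integrable_pow_mul_studentTPDF_five hk) hf
    (designMoment_odd (neg_mem_tails _) (by decide)) (designMoment_odd (neg_mem_tails _) (by decide))
    ?_ ?_ ?_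
  · intro x hx
    have hx2 : (Real.sqrt 5 * u) ^ 2 ≤ x ^ 2 := by
      have h5u : 0 ≤ Real.sqrt 5 * u := by positivity
      rcases hx with hx | hx
      · exact sq_le_sq_of_le_neg h5u hx
      · exact pow_le_pow_left₀ h5u hx 2
    rw [mul_pow, h5] at hx2
    exact mul_nonneg (by linarith) (by nlinarith [sq_nonneg x])
  · intro x hx
    simp only [hS, Set.mem_union, Set.mem_Iic, Set.mem_Ici, not_or, not_le] at hx
    have hx2 : x ^ 2 < (Real.sqrt 5 * u) ^ 2 := sq_lt_sq' hx.1 hx.2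
    rw [mul_pow, h5] at hx2
    exact mul_nonpos_of_nonpos_of_nonneg (by linarith) (by nlinarith [sq_nonneg x])
  · rw [m2', m4', hβdef]
    field_simp
    ring

/-- Here A and B are the squared endpoints, so the biquadratic is nonpositive exactly for b ≤ |x| ≤
a. By the half-angle identities, `heq` is the condition on A + B with denominators cleared. -/
lemma isTheDOptimalDensity_tails_union_Icc {y z P p₂ p₄ : ℝ} (h0 : 0 < y) (hz : 0 < z)
    (hyz : y + z < Real.pi)
    (hP : tailMass y + (3 * z + 4 * Real.sin z + Real.sin z * Real.cos z) = P)
    (hp₂ : p₂ = (y - Real.sin y * Real.cos y) + (z - Real.sin z * Real.cos z))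
    (hp₄ : p₄ = (3 * y + 4 * Real.sin y + Real.sin y * Real.cos y) +
        (3 * z - 4 * Real.sin z + Real.sin z * Real.cos z))
    (heq : P * p₂ * ((1 + Real.cos y) * (1 + Real.cos z) +
        (1 - Real.cos z) * (1 - Real.cos y)) =
        (3 * p₂ ^ 2 - P * p₄) * ((1 - Real.cos y) * (1 + Real.cos z))) (hP0 : 0 < P) :
    ∃ a b : ℝ, a > b ∧ b > 0 ∧ IsTheDOptimalDensity 2 (studentTPDF 5) (P / (3 * Real.pi))
      ((Set.Iic (-a) ∪ Set.Icc (-b) b ∪ Set.Ici a).indicator (studentTPDF 5)) := by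
  have hpi0 := Real.pi_pos
  have hpi : y < Real.pi := by linarith
  have hzpi : z < Real.pi := by linarith
  have h5 : Real.sqrt 5 ^ 2 = 5 := Real.sq_sqrt (by norm_num)
  have h54 : Real.sqrt 5 ^ 4 = 25 := by linear_combination (Real.sqrt 5 ^ 2 + 5) * h5
  have hv : 0 < Real.tan (z / 2) :=
    Real.tan_pos_of_pos_of_lt_pi_div_two (by linarith) (by linarith)
  have huv : Real.tan (z / 2) < Real.tan ((Real.pi - y) / 2) :=
    Real.tan_lt_tan_of_lt_of_lt_pi_div_two (by linarith) (by linarith) (by linarith)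
  have m0 := designMoment_tails_union_Icc (by norm_num) pow_zero_decomp hv.le huv
  have m2 := designMoment_tails_union_Icc (by norm_num) pow_two_decomp hv.le huv
  have m4 := designMoment_tails_union_Icc (by norm_num) pow_four_decomp hv.le huv
  rw [rationalPrimitive_tan_pi_sub _ _ _ h0 hpi,
    rationalPrimitive_tan _ _ _ (by linarith) hzpi] at m0 m2 m4
  have hu2 := tan_half_sq (w := Real.pi - y) (by linarith) (by linarith)
  have hv2 := tan_half_sq (w := z) (by linarith) hzpi
  rw [Real.cos_pi_sub] at hu2
  obtain ⟨hc1, hc2⟩ := cos_mem_Ioo h0 hpi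
  obtain ⟨hd1, hd2⟩ := cos_mem_Ioo hz hzpi
  have hp₂0 : 0 < p₂ := by
    rw [hp₂]
    exact add_pos (sub_sin_mul_cos_pos h0) (sub_sin_mul_cos_pos hz)
  set u := Real.tan ((Real.pi - y) / 2)
  set v := Real.tan (z / 2)
  have hu : 0 < u := hv.trans huv
  have hab : Real.sqrt 5 * v < Real.sqrt 5 * u := by gcongr
  refine ⟨Real.sqrt 5 * u, Real.sqrt 5 * v, hab, by positivity, ?_⟩
  set S := Set.Iic (-(Real.sqrt 5 * u)) ∪ Set.Icc (-(Real.sqrt 5 * v)) (Real.sqrt 5 * v) ∪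
    Set.Ici (Real.sqrt 5 * u) with hS
  have m0' : designMoment (S.indicator (studentTPDF 5)) 0 = P / (3 * Real.pi) := by
    rw [m0, ← hP, tailMass]; field_simp; ring
  have m2' : designMoment (S.indicator (studentTPDF 5)) 2 = 5 * p₂ / (3 * Real.pi) := by
    rw [m2, h5, hp₂]; field_simp; ring
  have m4' : designMoment (S.indicator (studentTPDF 5)) 4 = 25 * p₄ / (3 * Real.pi) := by
    rw [m4, h54, hp₄]; field_simp; ring
  have hf := isSubsamplingDesign_indicator
    (((measurableSet_Iic.union measurableSet_Icc).union measurableSet_Ici : MeasurableSet S))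
  rw [m0'] at hf
  have h5v : 0 ≤ Real.sqrt 5 * v := by positivity
  have hvu2 : v ^ 2 < u ^ 2 := by gcongr
  refine isTheDOptimalDensity_indicator (A := 5 * u ^ 2) (B := 5 * v ^ 2) (by positivity)
    (fun k hk => integrable_pow_mul_studentTPDF_five hk) hf
    (designMoment_odd (neg_mem_tails_union_Icc _ _) (by decide))
    (designMoment_odd (neg_mem_tails_union_Icc _ _) (by decide)) ?_ ?_ ?_
  · rintro x ((hx | hx) | hx)
    · have hx2 : (Real.sqrt 5 * u) ^ 2 ≤ x ^ 2 := sq_le_sq_of_le_neg (h5v.trans hab.le) hx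
      rw [mul_pow, h5] at hx2
      exact mul_nonneg (by linarith) (by linarith)
    · have hx2 : x ^ 2 ≤ (Real.sqrt 5 * v) ^ 2 := sq_le_sq' hx.1 hx.2
      rw [mul_pow, h5] at hx2
      exact mul_nonneg_of_nonpos_of_nonpos (by linarith) (by linarith)
    · have hx2 : (Real.sqrt 5 * u) ^ 2 ≤ x ^ 2 := pow_le_pow_left₀ (h5v.trans hab.le) hx 2
      rw [mul_pow, h5] at hx2
      exact mul_nonneg (by linarith) (by linarith)
  · intro x hx
    simp only [hS, Set.mem_union, Set.mem_Iic, Set.mem_Ici, Set.mem_Icc, not_or, not_le,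
      not_and_or] at hx
    have hx2 : x ^ 2 < (Real.sqrt 5 * u) ^ 2 := sq_lt_sq' hx.1.1 hx.2
    have hx3 : (Real.sqrt 5 * v) ^ 2 < x ^ 2 := by
      rcases hx.1.2 with h | h
      · rw [← neg_sq x]
        exact pow_lt_pow_left₀ (lt_neg.1 h) h5v two_ne_zero
      · exact pow_lt_pow_left₀ h h5v two_ne_zero
    rw [mul_pow, h5] at hx2 hx3
    exact mul_nonpos_of_nonpos_of_nonneg (by linarith) (by linarith)
  · have key : P * p₂ * (u ^ 2 + v ^ 2) = 3 * p₂ ^ 2 - P * p₄ := by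
      have hne : (1 - Real.cos y) * (1 + Real.cos z) ≠ 0 := by
        apply mul_ne_zero <;> linarith
      apply mul_right_cancel₀ hne
      rw [← heq]
      linear_combination P * p₂ * (1 + Real.cos z) * hu2 + P * p₂ * (1 - Real.cos y) * hv2
    rw [m2', m4']
    linear_combination 25 / (9 * Real.pi ^ 2) * key

theorem mainTheorem6 :
    ∃ αc : ℝ, |αc - 0.082069| < 0.0000005 ∧ |αc - 0.082065| < 0.000005 ∧
      (∀ α : ℝ, 0 < α → α < αc →
        ∃ a b : ℝ, a > b ∧ b > 0 ∧
          IsTheDOptimalDensity 2 (studentTPDF 5) α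
            (Set.indicator (Set.Iic (-a) ∪ Set.Icc (-b) b ∪ Set.Ici a) (studentTPDF 5))) ∧
      (∀ α : ℝ, αc ≤ α → α < 1 →
        IsTheDOptimalDensity 2 (studentTPDF 5) α
          (Set.indicator
            (Set.Iic (-quantile (studentTMeasure 5) (1 - α / 2)) ∪
              Set.Ici (quantile (studentTMeasure 5) (1 - α / 2)))
            (studentTPDF 5))) := by
  have hpi0 := Real.pi_pos
  obtain ⟨y₀, hy₀, hy₀pi, habs, hneg, hpos⟩ := exists_criticalAngle
  -- Every proportion is the mass of a pair of tails, so comparing proportions amounts to comparing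
  -- angles with y₀.
  have hangle : ∀ α : ℝ, 0 < α → α < 1 →
      ∃ y, 0 < y ∧ y < Real.pi ∧ α = tailMass y / (3 * Real.pi) := by
    intro α h0 h1
    obtain ⟨y, hy, hyα⟩ := intermediate_value_Ioo hpi0.le tailMass_continuous.continuousOn
      (show 3 * Real.pi * α ∈ Set.Ioo (tailMass 0) (tailMass Real.pi) by
        rw [tailMass_zero, tailMass_pi]
        exact ⟨by positivity, by nlinarith⟩)
    exact ⟨y, hy.1, hy.2, by rw [hyα]; field_simp⟩
  have habs' := abs_lt.1 habs
  refine ⟨tailMass y₀ / (3 * Real.pi), habs, ?_, fun α h0 hα => ?_, fun α hα h1 => ?_⟩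
  · rw [abs_lt]
    constructor <;> linarith [habs'.1, habs'.2]
  · obtain ⟨y₁, hy₁, hy₁pi, rfl⟩ := hangle α h0 (by linarith [habs'.2])
    rw [div_lt_div_iff_of_pos_right (by positivity),
      tailMass_strictMonoOn.lt_iff_lt ⟨hy₁.le, hy₁pi.le⟩ ⟨hy₀.le, hy₀pi.le⟩] at hα
    obtain ⟨y, z, p₂, p₄, hy, hz, hyz, hP, hp₂, hp₄, heq⟩ :=
      exists_angles hy₁ hy₁pi (hneg y₁ hy₁ hα)
    exact isTheDOptimalDensity_tails_union_Icc hy hz hyz hP hp₂ hp₄ heq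
      ((div_pos_iff_of_pos_right (by positivity)).1 h0)
  · obtain ⟨y, hy, hypi, rfl⟩ := hangle α (by linarith [habs'.1]) h1
    rw [div_le_div_iff_of_pos_right (by positivity),
      tailMass_strictMonoOn.le_iff_le ⟨hy₀.le, hy₀pi.le⟩ ⟨hy.le, hypi.le⟩] at hα
    rw [quantile_studentTMeasure hy hypi]
    exact isTheDOptimalDensity_tails hy hypi (hpos y hα hypi)
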